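/- Alphabets are finite, and every output alphabet carries a linear (alphabetical) order. A (multi-valued partial) function is a map $f:\Sigma^*\to\mathcal P(\Gamma^*)$ for some alphabets $\Sigma,\Gamma$; it is single-valued if $|f(x)|\le 1$ and total if $f(x)\ne\emptyset$ for all $x$. An npda with output is a one-way nondeterministic pushdown automaton (input between endmarkers, $\lambda$-moves allowed, accepting and rejecting halting states) with a write-only output tape, on which at most one symbol is written per step, such that on every input $x$ all computation paths reach a halting state within $O(|x|)$ steps. Its valid outputs on $x$ are the strings produced along its accepting paths. $\mathrm{CFLSV_t}$ is the class of single-valued total functions $f$ such that, for some npda with output, $f(x)$ is the set of its valid outputs on $x$, for every $x$. $\mathrm{OptCFL}$ is the class of single-valued total functions $f$ for which there are an npda $M$ with output and an $opt\in\{\max,\min\}$ such that, for every $x$, $M$ has an accepting path on $x$ and $f(x)$ is the $opt$ of the valid outputs of $M$ on $x$, in the dictionary order of $\Gamma^*$ (in which a proper prefix of a string precedes it). An oracle npda has in addition a write-only query tape and states $q_{query},q_{yes},q_{no}$: when it enters $q_{query}$ with $s$ on the query tape, the query tape is blanked and the next state is $q_{yes}$ if $s$ is in the oracle and $q_{no}$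 otherwise; all its computation paths must reach a halting state in $O(|x|)$ steps no matter what oracle is used. $\mathrm{CFL}_T(\mathcal C)$ is the family of languages recognized by oracle npda's with an oracle in $\mathcal C$. Put $\Sigma_1^{\mathrm{CFL}}=\mathrm{CFL}$ (the context-free languages), let $\Pi_k^{\mathrm{CFL}}$ be the family of complements of languages in $\Sigma_k^{\mathrm{CFL}}$, and $\Sigma_{k+1}^{\mathrm{CFL}}=\mathrm{CFL}_T(\Pi_k^{\mathrm{CFL}})$. For $k\ge1$, $\Sigma_{k+1}^{\mathrm{CFL}}\mathrm{SV_t}$ is the class of single-valued total functions $f$ for which there is an oracle npda with an output tape and an oracle in $\Pi_k^{\mathrm{CFL}}$ such that $f(x)$ is the set of valid outputs on $x$, for every $x$. Then $$\mathrm{CFLSV_t}\subsetneq\mathrm{OptCFL}\subseteq\Sigma_4^{\mathrm{CFL}}\mathrm{SV_t}.$$ Moreover, the function $f(w)=\max g(w)$ (dictionary order, $0<1$) on $w\in\{0,1,\natural,\#\}^*$, where $$g(w)=\{\lambda\}\cup\{x_iy_i \mid w=x_1\natural x_2\natural x_3\# y_1\natural y_2\natural y_3,\ x_j,y_j\in\{0,1\}^*\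 (1\le j\le 3),\ x_i=y_i^R,\ i\in\{1,2,3\}\},$$ belongs to $\mathrm{OptCFL}$ but not to $\mathrm{CFLSV_t}$. -/

import Mathlib

/-! Pushdown transducers, oracle pushdown transducers, the CFL hierarchy and the function
classes built from them. -/

namespace CFLFun

/-- The input tape alphabet: an input alphabet together with the two endmarkers. -/
inductive Tape (S : Type) : Type
  | left : Tape S
  | sym : S → Tape S
  | right : Tape S

/-- The content of the input tape on input `x`: `x` between the two endmarkers. -/
def tapeOf {S : Type} (x : List S) : List (Tape S) :=
  Tape.left :: (x.map Tape.sym ++ [Tape.right])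

/-- `StepsIn r a n b`: there is an `r`-path of exactly `n` steps from `a` to `b`. -/
inductive StepsIn {α : Type} (r : α → α → Prop) (a : α) : ℕ → α → Prop
  | refl : StepsIn r a 0 a
  | tail {n : ℕ} {b c : α} : StepsIn r a n b → r b c → StepsIn r a (n + 1) c

/-! ### Npda's with a write-only output tape -/

/-- A one-way one-head nondeterministic pushdown automaton with input alphabet `S` and a
write-only output tape over `G`.  In `trans q a Z`, the value `a = none` is a `λ`-move of the input
head, `a = some σ` reads `σ` and moves on.  An element `(p, w, o)` of `trans q a Z` means: enter `p`,
replace the topmost stack symbol `Z` by the string `w`, write `o` (or nothing) on the output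
tape. Values of `trans` at halting states are never used. -/
structure NPDA (S G : Type) where
  /-- inner states -/
  Q : Type
  /-- stack alphabet -/
  Stk : Type
  finQ : Finite Q
  finStk : Finite Stk
  start : Q
  bottom : Stk
  acc : Set Q
  rej : Set Q
  disj : Disjoint acc rej
  trans : Q → Option (Tape S) → Stk → Set (Q × List Stk × Option G)
  finTrans : ∀ q a Z, (trans q a Z).Finite

namespace NPDA

variable {S G : Type}

/-- A configuration: inner state, unread part of the input tape, stack content (top first),
content of the output tape. -/
structure Config (M : NPDA S G) where
  state : M.Q
  input : List (Tape S)
  stack : List M.Stk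
  output : List G

def init (M : NPDA S G) (x : List S) : M.Config :=
  ⟨M.start, tapeOf x, [M.bottom], []⟩

/-- Halting states. -/
def halt (M : NPDA S G) : Set M.Q := M.acc ∪ M.rej

/-- One step of the machine. Halting configurations have no successors. -/
inductive Step (M : NPDA S G) : M.Config → M.Config → Prop
  | stay {q p : M.Q} {u : List (Tape S)} {Z : M.Stk} {v w : List M.Stk} {o : Option G}
      {y : List G} : q ∉ M.halt → (p, w, o) ∈ M.trans q none Z →
      Step M ⟨q, u, Z :: v, y⟩ ⟨p, u, w ++ v, y ++ o.toList⟩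
  | read {q p : M.Q} {a : Tape S} {u : List (Tape S)} {Z : M.Stk} {v w : List M.Stk}
      {o : Option G} {y : List G} : q ∉ M.halt → (p, w, o) ∈ M.trans q (some a) Z →
      Step M ⟨q, a :: u, Z :: v, y⟩ ⟨p, u, w ++ v, y ++ o.toList⟩

/-- The termination condition: on every input, every computation path reaches a halting state
within linearly many steps (so no path is longer than the bound, and none gets stuck
in a non-halting state). -/
def Terminates (M : NPDA S G) : Prop :=
  ∃ a b : ℕ, ∀ (x : List S) (n : ℕ) (c : M.Config), StepsIn M.Step (M.init x) n c →
    n ≤ a * x.length + b ∧ (c.state ∈ M.halt ∨ ∃ c', M.Step c c')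

/-- The valid outputs of `M` on `x`: those produced along accepting computation paths. -/
def outputs (M : NPDA S G) (x : List S) : Set (List G) :=
  {y | ∃ (n : ℕ) (c : M.Config), StepsIn M.Step (M.init x) n c ∧ c.state ∈ M.acc ∧ c.output = y}

end NPDA

/-! ### Oracle npda's -/

/-- An npda with input alphabet `S`, a write-only output tape over `G`, a write-only query tape over
`D`, and three extra states `query`, `yes`, `no`.  An element `(p, w, d, o)` of `trans q a Z` means:
enter `p`, replace `Z` by `w`, write `d` (or nothing) on the query tape and `o` (or
nothing) on the output tape.  Values of `trans` at halting states and at `query` are never used. -/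
structure OracleNPDA (S D G : Type) where
  /-- inner states -/
  Q : Type
  /-- stack alphabet -/
  Stk : Type
  finQ : Finite Q
  finStk : Finite Stk
  start : Q
  bottom : Stk
  acc : Set Q
  rej : Set Q
  disj : Disjoint acc rej
  query : Q
  yes : Q
  no : Q
  query_ne_yes : query ≠ yes
  query_ne_no : query ≠ no
  yes_ne_no : yes ≠ no
  query_notMem : query ∉ acc ∪ rej
  trans : Q → Option (Tape S) → Stk → Set (Q × List Stk × Option D × Option G)
  finTrans : ∀ q a Z, (trans q a Z).Finite

namespace OracleNPDA

variable {S D G : Type}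

/-- A configuration: inner state, unread part of the input tape, stack content (top first),
contents of the query tape and of the output tape. -/
structure Config (M : OracleNPDA S D G) where
  state : M.Q
  input : List (Tape S)
  stack : List M.Stk
  queryTape : List D
  output : List G

def init (M : OracleNPDA S D G) (x : List S) : M.Config :=
  ⟨M.start, tapeOf x, [M.bottom], [], []⟩

/-- Halting states. -/
def halt (M : OracleNPDA S D G) : Set M.Q := M.acc ∪ M.rej

/-- One step of the machine with oracle `A`. In the query state the only step is the oracle call,
which blanks the query tape and leads to `yes` or `no` according to the oracle's answer. -/
inductive Step (M : OracleNPDA S D G) (A : Language D) : M.Config → M.Config → Prop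
  | stay {q p : M.Q} {u : List (Tape S)} {Z : M.Stk} {v w : List M.Stk} {d : Option D}
      {o : Option G} {s : List D} {y : List G} : q ∉ M.halt → q ≠ M.query →
      (p, w, d, o) ∈ M.trans q none Z →
      Step M A ⟨q, u, Z :: v, s, y⟩ ⟨p, u, w ++ v, s ++ d.toList, y ++ o.toList⟩
  | read {q p : M.Q} {a : Tape S} {u : List (Tape S)} {Z : M.Stk} {v w : List M.Stk}
      {d : Option D} {o : Option G} {s : List D} {y : List G} : q ∉ M.halt → q ≠ M.query →
      (p, w, d, o) ∈ M.trans q (some a) Z →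
      Step M A ⟨q, a :: u, Z :: v, s, y⟩ ⟨p, u, w ++ v, s ++ d.toList, y ++ o.toList⟩
  | ask_yes {u : List (Tape S)} {v : List M.Stk} {s : List D} {y : List G} : s ∈ A →
      Step M A ⟨M.query, u, v, s, y⟩ ⟨M.yes, u, v, [], y⟩
  | ask_no {u : List (Tape S)} {v : List M.Stk} {s : List D} {y : List G} : s ∉ A →
      Step M A ⟨M.query, u, v, s, y⟩ ⟨M.no, u, v, [], y⟩

/-- The termination condition: every computation path reaches a halting state within linearly
many steps, no matter what oracle is used. -/
def Terminates (M : OracleNPDA S D G) : Prop :=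
  ∃ a b : ℕ, ∀ (A : Language D) (x : List S) (n : ℕ) (c : M.Config),
    StepsIn (M.Step A) (M.init x) n c →
      n ≤ a * x.length + b ∧ (c.state ∈ M.halt ∨ ∃ c', M.Step A c c')

/-- The valid outputs of `M` with oracle `A` on `x`. -/
def outputs (M : OracleNPDA S D G) (A : Language D) (x : List S) : Set (List G) :=
  {y | ∃ (n : ℕ) (c : M.Config),
    StepsIn (M.Step A) (M.init x) n c ∧ c.state ∈ M.acc ∧ c.output = y}

/-- `M` with oracle `A` accepts `x`: some computation path is accepting. -/
def Accepts (M : OracleNPDA S D G) (A : Language D) (x : List S) : Prop :=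
  ∃ (n : ℕ) (c : M.Config), StepsIn (M.Step A) (M.init x) n c ∧ c.state ∈ M.acc

end OracleNPDA

/-! ### The CFL hierarchy of language families -/

/-- A language over some alphabet. -/
structure Lang where
  Alph : Type
  fin : Finite Alph
  lang : Language Alph

/-- Context-free languages. -/
def CFL : Set Lang := {L | L.lang.IsContextFree}

/-- Complements of the members of `C`. -/
def co (C : Set Lang) : Set Lang := {L | (⟨L.Alph, L.fin, L.langᶜ⟩ : Lang) ∈ C}

/-- Turing relativization of `CFL`: languages recognized by oracle npda's (whose output tape
plays no role: it has the empty alphabet) with an oracle from `C`. -/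
def CFLT (C : Set Lang) : Set Lang :=
  {L | ∃ A ∈ C, ∃ M : OracleNPDA L.Alph A.Alph Empty, M.Terminates ∧
    ∀ x, x ∈ L.lang ↔ M.Accepts A.lang x}

/-- The classes `Σ_k^CFL`, `k ≥ 1` (the value at `0` is not used), where `Π_k^CFL = co Σ_k^CFL`. -/
def SigmaCFL : ℕ → Set Lang
  | 0 => ∅
  | 1 => CFL
  | k + 2 => CFLT (co (SigmaCFL (k + 1)))

def PiCFL (k : ℕ) : Set Lang := co (SigmaCFL k)

/-! ### Function classes -/

/-- A multi-valued partial function from strings over the alphabet `In` to strings over the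
(alphabetically ordered) alphabet `Out`. -/
structure MVFun where
  In : Type
  Out : Type
  finIn : Finite In
  finOut : Finite Out
  ord : LinearOrder Out
  val : List In → Set (List Out)

def MVFun.SingleValued (f : MVFun) : Prop := ∀ x, (f.val x).Subsingleton

def MVFun.Total (f : MVFun) : Prop := ∀ x, (f.val x).Nonempty

def CFLMV : Set MVFun :=
  {f | ∃ M : NPDA f.In f.Out, M.Terminates ∧ ∀ x, f.val x = M.outputs x}

def CFLSV : Set MVFun := {f | f ∈ CFLMV ∧ f.SingleValued}

/-- Single-valued total functions in `CFLMV`. -/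
def CFLSVt : Set MVFun := {f | f ∈ CFLSV ∧ f.Total}

/-- Turing relativization of `CFLMV` to oracles from `C`. -/
def CFLMVT (C : Set Lang) : Set MVFun :=
  {f | ∃ A ∈ C, ∃ M : OracleNPDA f.In A.Alph f.Out, M.Terminates ∧
    ∀ x, f.val x = M.outputs A.lang x}

def CFLSVT (C : Set Lang) : Set MVFun := {f | f ∈ CFLMVT C ∧ f.SingleValued}

/-- The classes `Σ_k^CFL SV`, `k ≥ 1` (the value at `0` is not used). -/
def SigmaCFLSV : ℕ → Set MVFun
  | 0 => ∅
  | 1 => CFLSV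
  | k + 2 => CFLSVT (PiCFL (k + 1))

/-- The total functions in `Σ_k^CFL SV`. -/
def SigmaCFLSVt (k : ℕ) : Set MVFun := {f | f ∈ SigmaCFLSV k ∧ f.Total}

/-- `y` is the maximum of `Y` in the dictionary order (a proper prefix of a string precedes it). -/
def IsDictMax {G : Type} (ord : LinearOrder G) (Y : Set (List G)) (y : List G) : Prop :=
  y ∈ Y ∧ ∀ z ∈ Y, z = y ∨ List.Lex ord.lt z y

/-- `y` is the minimum of `Y` in the dictionary order. -/
def IsDictMin {G : Type} (ord : LinearOrder G) (Y : Set (List G)) (y : List G) : Prop :=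
  y ∈ Y ∧ ∀ z ∈ Y, z = y ∨ List.Lex ord.lt y z

/-- `OptCFL`: single-valued total functions whose value at every `x` is the maximum (or, at every
`x`, the minimum) of the valid outputs of a fixed npda on `x`; in particular the npda has an
accepting computation path on every input. -/
def OptCFL : Set MVFun :=
  {f | ∃ M : NPDA f.In f.Out, M.Terminates ∧
    ((∀ x, ∃ y, f.val x = {y} ∧ IsDictMax f.ord (M.outputs x) y) ∨
     (∀ x, ∃ y, f.val x = {y} ∧ IsDictMin f.ord (M.outputs x) y))}

/-! ### The separating function -/

/-- The alphabet consisting of the bits `0`, `1` and the separators `♮`, `#`. -/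
inductive PalSym : Type
  | bit (b : Bool) : PalSym
  | nat : PalSym
  | hash : PalSym

theorem PalSym.finite : Finite PalSym := by
  refine Finite.of_injective
    (fun s : PalSym => match s with
      | .bit b => some (some b)
      | .nat => some none
      | .hash => (none : Option (Option Bool))) ?_
  intro s t h
  cases s <;> cases t <;> simp_all

def bits (x : List Bool) : List PalSym := x.map PalSym.bit

/-- `{λ} ∪ {x_i y_i | w = x_1 ♮ x_2 ♮ x_3 # y_1 ♮ y_2 ♮ y_3, x_i = y_i^R, i ∈ {1,2,3}}`. -/
def palPairs (w : List PalSym) : Set (List Bool) :=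
  {[]} ∪ {s | ∃ x y : Fin 3 → List Bool,
    w = bits (x 0) ++ [PalSym.nat] ++ bits (x 1) ++ [PalSym.nat] ++ bits (x 2) ++ [PalSym.hash] ++
        bits (y 0) ++ [PalSym.nat] ++ bits (y 1) ++ [PalSym.nat] ++ bits (y 2) ∧
    ∃ i, x i = (y i).reverse ∧ s = x i ++ y i}

/-- `w ↦ max (palPairs w)`, with `0 < 1`. -/
def maxPalPair : MVFun where
  In := PalSym
  Out := Bool
  finIn := PalSym.finite
  finOut := inferInstance
  ord := inferInstance
  val w := {s | IsDictMax inferInstance (palPairs w) s}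

end CFLFun

namespace CFLFun

/-! ### Paths -/

/-! A single output is its own maximum, so `CFLSVt ⊆ OptCFL`. The inclusion is strict because of
`maxPalPair`. It is an optimum by construction: `palNPDA` either halts at once with empty output, or
guesses an index, checks with its stack that the two blocks are mirror images, and writes both.

That `maxPalPair` is not in `CFLSVt` depends only on where it takes the value `[]`. Since `[]` is
least in dictionary order, an npda whose only output is the value of `maxPalPair` can output `[]` on
`w` exactly when `palPairs w = {[]}` (`nil_mem_maxPalPair_iff`). Its runs that write nothing would
thus recognize these `w`, and on the words `0^i ♮ 0^i ♮ # 0^l ♮ 0^l ♮` this means verifying two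
crossing inequalities with one stack. Consider where the stack is lowest between the ends of the
first left and the first right block. If that is after `#`, the run has a self-contained segment
covering the second left block but not the second right one; otherwise it has one covering the first
right block but not the first left one (`exists_cut`). Segments with equal boundary data, of which
there are finitely many, can be exchanged between runs. Colouring each pair `i < l` by its data
gives equally coloured pairs `(i, j)` and `(j, l)` (`exists_monochromatic_chain`), and the exchange
yields a silently accepted word with two matching blocks of the same nonzero length, a
contradiction.

For the upper bound, the optimum is the one output that no other output beats. Each negation costs a
level. That two interleaved strings differ is decided by a counter machine, so their equality is in
`PiCFL 2` (`match_mem_PiCFL`). "Some output on `x` beats `y`" is decided by simulating the machine,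
guessing the first place of difference, and querying the equality of the two prefixes; its
complement is in `PiCFL 3` (`beatenLang_compl_mem_PiCFL`). Finally, a machine simulates again,
copies input and output to the query tape, and asks whether the output is unbeaten. Both simulations
are instances of `Controller.sim`. -/

theorem StepsIn.trans {α : Type} {r : α → α → Prop} {a b c : α} {m n : ℕ}
    (h₁ : StepsIn r a m b) (h₂ : StepsIn r b n c) : StepsIn r a (m + n) c := by
  induction h₂ with
  | refl => exact h₁
  | tail _ h ih => exact ih.tail h

theorem StepsIn.head {α : Type} {r : α → α → Prop} {a b c : α} {n : ℕ}
    (h₁ : r a b) (h₂ : StepsIn r b n c) : StepsIn r a (n + 1) c := by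
  rw [Nat.add_comm]
  exact (StepsIn.refl.tail h₁).trans h₂

instance Tape.finite {S : Type} [Finite S] : Finite (Tape S) := by
  refine Finite.of_injective (fun s : Tape S => match s with
      | .left => (none : Option (Option S))
      | .right => some none
      | .sym a => some (some a)) ?_
  intro s t h
  cases s <;> cases t <;> simp_all

namespace NPDA

variable {S G : Type}

/-- A bound on what one move can push leaves finitely many possible strings; this keeps the
colouring of runs and the moves of the simulating machine finite. -/
theorem exists_push_bound [Finite S] (M : NPDA S G) :
    ∃ L, ∀ q a Z, ∀ r ∈ M.trans q a Z, r.2.1.length ≤ L := by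
  have := M.finQ
  have := M.finStk
  have hfin : (⋃ (t : M.Q × Option (Tape S) × M.Stk),
      (fun r : M.Q × List M.Stk × Option G => r.2.1.length) ''
        M.trans t.1 t.2.1 t.2.2).Finite :=
    Set.finite_iUnion fun t => (M.finTrans _ _ _).image _
  obtain ⟨L, hL⟩ := hfin.bddAbove
  exact ⟨L, fun q a Z r hr => hL (Set.mem_iUnion.2 ⟨(q, a, Z), r, hr, rfl⟩)⟩

theorem Step.of_trans {M : NPDA S G} {q p : M.Q} {a : Option (Tape S)} {u : List (Tape S)}
    {Z : M.Stk} {v w : List M.Stk} {o : Option G} {y : List G} (hq : q ∉ M.halt)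
    (ht : (p, w, o) ∈ M.trans q a Z) :
    M.Step ⟨q, a.toList ++ u, Z :: v, y⟩ ⟨p, u, w ++ v, y ++ o.toList⟩ := by
  rcases a with _ | a
  · exact .stay hq ht
  · exact .read hq ht

theorem Step.inv {M : NPDA S G} {q : M.Q} {u : List (Tape S)} {γ : List M.Stk} {y : List G}
    {c : M.Config} (h : M.Step ⟨q, u, γ, y⟩ c) :
    q ∉ M.halt ∧ ∃ a u' Z v p w o, u = a.toList ++ u' ∧ γ = Z :: v ∧
      (p, w, o) ∈ M.trans q a Z ∧ c = ⟨p, u', w ++ v, y ++ o.toList⟩ := by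
  cases h with
  | stay hq ht => exact ⟨hq, none, _, _, _, _, _, _, rfl, rfl, ht, rfl⟩
  | read hq ht => exact ⟨hq, some _, _, _, _, _, _, _, rfl, rfl, ht, rfl⟩

/-! ### Runs without output -/

/-- `M.Silent q γ u p δ`: started in state `q` with stack `γ`, the machine can read exactly `u`,
write nothing, and arrive in state `p` with stack `δ`. -/
inductive Silent (M : NPDA S G) :
    M.Q → List M.Stk → List (Tape S) → M.Q → List M.Stk → Prop
  | refl (q : M.Q) (γ : List M.Stk) : Silent M q γ [] q γ
  | step {q p r : M.Q} {Z : M.Stk} {v w γ : List M.Stk} {a : Option (Tape S)}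
      {u : List (Tape S)} : q ∉ M.halt → (p, w, none) ∈ M.trans q a Z →
      Silent M p (w ++ v) u r γ → Silent M q (Z :: v) (a.toList ++ u) r γ

namespace Silent

variable {M : NPDA S G} {q p r : M.Q} {α β γ δ : List M.Stk} {u v : List (Tape S)}

theorem trans (h₁ : M.Silent q γ u p δ) (h₂ : M.Silent p δ v r β) :
    M.Silent q γ (u ++ v) r β := by
  induction h₁ with
  | refl => exact h₂
  | step hq ht _ ih =>
    rw [List.append_assoc]
    exact .step hq ht (ih h₂)

theorem frame (h : M.Silent q γ u p δ) (β : List M.Stk) :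
    M.Silent q (γ ++ β) u p (δ ++ β) := by
  induction h with
  | refl => exact .refl _ _
  | step hq ht _ ih =>
    refine .step hq ht ?_
    rw [List.append_assoc] at ih
    exact ih

theorem split (h : M.Silent q γ u p δ) : ∀ u₁ u₂, u = u₁ ++ u₂ →
    ∃ r β, M.Silent q γ u₁ r β ∧ M.Silent r β u₂ p δ := by
  induction h with
  | refl q γ =>
    intro u₁ u₂ h
    obtain ⟨rfl, rfl⟩ := List.append_eq_nil_iff.1 h.symm
    exact ⟨q, γ, .refl _ _, .refl _ _⟩
  | @step q p r Z v w γ a u hq ht hs ih =>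
    intro u₁ u₂ h
    rcases a with _ | a
    · obtain ⟨s, β, h₁, h₂⟩ := ih u₁ u₂ h
      exact ⟨s, β, .step hq ht h₁, h₂⟩
    · rcases u₁ with _ | ⟨b, u₁⟩
      · refine ⟨q, Z :: v, .refl _ _, ?_⟩
        obtain rfl : _ = u₂ := h
        exact .step hq ht hs
      · simp only [Option.toList_some, List.cons_append, List.nil_append, List.cons.injEq] at h
        obtain ⟨rfl, h⟩ := h
        obtain ⟨s, β, h₁, h₂⟩ := ih u₁ u₂ h
        exact ⟨s, β, .step hq ht h₁, h₂⟩

/-- Either the upper part `α` of the stack gets popped at some time, or the lower part is never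
touched. -/
theorem pop_or_stay (h : M.Silent q γ u p δ) : ∀ α β, γ = α ++ β →
    (∃ u₁ u₂ r, u = u₁ ++ u₂ ∧ M.Silent q α u₁ r [] ∧ M.Silent r β u₂ p δ) ∨
      ∃ α', M.Silent q α u p α' ∧ δ = α' ++ β := by
  induction h with
  | refl q γ =>
    rintro α β rfl
    exact .inr ⟨α, .refl _ _, rfl⟩
  | @step q p r Z v w γ a u hq ht hs ih =>
    intro α β h
    rcases α with _ | ⟨X, α⟩
    · obtain rfl : _ = β := h
      exact .inl ⟨[], _, q, rfl, .refl _ _, .step hq ht hs⟩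
    · simp only [List.cons_append, List.cons.injEq] at h
      obtain ⟨rfl, rfl⟩ := h
      rcases ih (w ++ α) β (by simp) with ⟨u₁, u₂, s, rfl, h₁, h₂⟩ | ⟨α', h₁, h₂⟩
      · exact .inl ⟨a.toList ++ u₁, u₂, s, by simp, .step hq ht h₁, h₂⟩
      · exact .inr ⟨α', .step hq ht h₁, h₂⟩

/-- A run that ends with a nonempty stack can be split where its stack is lowest. -/
theorem low_point (h : M.Silent q γ u p δ) (hδ : δ ≠ []) :
    ∃ u₁ u₂ r α Z β α', u = u₁ ++ u₂ ∧ γ = α ++ Z :: β ∧ δ = α' ++ β ∧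
      M.Silent q α u₁ r [] ∧ M.Silent r [Z] u₂ p α' := by
  induction h with
  | refl q γ =>
    obtain ⟨Z, β, rfl⟩ := List.exists_cons_of_ne_nil hδ
    exact ⟨[], [], q, [], Z, β, [Z], rfl, rfl, rfl, .refl _ _, .refl _ _⟩
  | @step q p r Z v w γ a u hq ht hs ih =>
    obtain ⟨u₁, u₂, s, α, Y, β, α', rfl, h, rfl, h₁, h₂⟩ := ih hδ
    rcases List.append_eq_append_iff.1 h with ⟨α₀, rfl, rfl⟩ | ⟨β₀, rfl, hβ⟩
    · exact ⟨a.toList ++ u₁, u₂, s, Z :: α₀, Y, β, α', by simp, rfl, rfl,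
        .step hq ht h₁, h₂⟩
    · rcases β₀ with _ | ⟨Y', β₀⟩
      · obtain rfl : Y :: β = v := hβ
        exact ⟨a.toList ++ u₁, u₂, s, [Z], Y, β, α', by simp, rfl, rfl,
          .step hq ht (by simpa using h₁), h₂⟩
      · simp only [List.cons_append, List.cons.injEq] at hβ
        obtain ⟨rfl, rfl⟩ := hβ
        -- The low point lies inside the string that replaced `Z`, so the stack never falls below
        -- the level of `Z`, and the initial configuration can serve as the low point.
        refine ⟨[], _, q, [], Z, v, α' ++ β₀, rfl, rfl, by simp, .refl _ _, .step hq ht ?_⟩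
        have := (h₁.frame (Y :: β₀)).trans (h₂.frame β₀)
        simpa using this

/-- The part `α` of the final stack above `δ` goes back to a bounded string pushed on `δ`, unless
it was there from the beginning. -/
theorem last_push {L : ℕ} (hL : ∀ q a Z, ∀ r ∈ M.trans q a Z, r.2.1.length ≤ L)
    (h : M.Silent q γ u p β) : ∀ α δ, β = α ++ δ →
    (∃ w, γ = w ++ δ ∧ M.Silent q w u p α) ∨
      ∃ u₁ u₂ r w, u = u₁ ++ u₂ ∧ w.length ≤ L ∧ M.Silent q γ u₁ r (w ++ δ) ∧
        M.Silent r w u₂ p α := by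
  induction h with
  | refl q γ =>
    rintro α δ rfl
    exact .inl ⟨α, rfl, .refl _ _⟩
  | @step q p r Z v w γ a u hq ht hs ih =>
    rintro α δ rfl
    rcases ih α δ rfl with ⟨w₁, h, h₁⟩ | ⟨u₁, u₂, s, w₁, rfl, hw, h₁, h₂⟩
    · rcases List.append_eq_append_iff.1 h with ⟨α₀, rfl, rfl⟩ | ⟨β₀, rfl, rfl⟩
      · exact .inl ⟨Z :: α₀, rfl, .step hq ht h₁⟩
      -- Here `δ` reaches up into the string pushed by this very move, so `w₁` is part of that
      -- string and has length at most `L`.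
      · have hw := hL _ _ _ _ ht
        simp only [List.length_append] at hw
        refine .inr ⟨a.toList, u, p, w₁, rfl, by omega, ?_, h₁⟩
        have := Silent.step (v := v) (u := []) hq ht (.refl _ _)
        simpa using this
    · exact .inr ⟨a.toList ++ u₁, u₂, s, w₁, by simp, hw, .step hq ht h₁, h₂⟩

theorem nonempty_of_read (h : M.Silent q γ u p δ) (hu : u ≠ []) : γ ≠ [] := by
  cases h with
  | refl => exact absurd rfl hu
  | step => simp

theorem exists_stepsIn (h : M.Silent q γ u p δ) (v : List (Tape S)) :
    ∃ n, StepsIn M.Step ⟨q, u ++ v, γ, []⟩ n ⟨p, v, δ, []⟩ := by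
  induction h with
  | refl q γ => exact ⟨0, .refl⟩
  | @step q p r Z w' w γ a u hq ht hs ih =>
    obtain ⟨n, hn⟩ := ih
    refine ⟨n + 1, StepsIn.head ?_ hn⟩
    have := Step.of_trans (u := u ++ v) (v := w') (y := []) hq ht
    simpa using this

end Silent

/-- The output tape only grows, so an empty final output forces every step to be silent. -/
theorem silent_of_stepsIn {M : NPDA S G} {x : List S} {n : ℕ} {c : M.Config}
    (h : StepsIn M.Step (M.init x) n c) (hc : c.output = []) :
    ∃ u, tapeOf x = u ++ c.input ∧ M.Silent M.start [M.bottom] u c.state c.stack := by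
  induction h with
  | refl => exact ⟨[], rfl, .refl _ _⟩
  | tail _ hs ih =>
    cases hs with
    | @stay q p u Z v w o y hq ht =>
      simp only [List.append_eq_nil_iff, Option.toList_eq_nil_iff] at hc
      obtain ⟨rfl, rfl⟩ := hc
      obtain ⟨u', hu, h'⟩ := ih rfl
      have := h'.trans (Silent.step (v := v) (u := []) hq ht (.refl _ _))
      exact ⟨u', hu, by simpa using this⟩
    | @read q p a u Z v w o y hq ht =>
      simp only [List.append_eq_nil_iff, Option.toList_eq_nil_iff] at hc
      obtain ⟨rfl, rfl⟩ := hc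
      obtain ⟨u', hu, h'⟩ := ih rfl
      have := h'.trans (Silent.step (v := v) (u := []) hq ht (.refl _ _))
      exact ⟨u' ++ [a], by simpa using hu, by simpa using this⟩

theorem nil_mem_outputs_iff {M : NPDA S G} {x : List S} :
    [] ∈ M.outputs x ↔ ∃ u v q γ, tapeOf x = u ++ v ∧
      M.Silent M.start [M.bottom] u q γ ∧ q ∈ M.acc := by
  constructor
  · rintro ⟨n, c, h, hc, ho⟩
    obtain ⟨u, hu, h'⟩ := silent_of_stepsIn h ho
    exact ⟨u, _, _, _, hu, h', hc⟩
  · rintro ⟨u, v, q, γ, hu, h, hq⟩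
    obtain ⟨n, hn⟩ := h.exists_stepsIn v
    refine ⟨n, ⟨q, v, γ, []⟩, ?_, hq, rfl⟩
    rw [NPDA.init, hu]
    exact hn

end NPDA
end CFLFun

namespace CFLFun

/-! ### The separating function is not computed by a single-valued npda -/

/-- If every pair `i < j` has one of finitely many colours, then two consecutive pairs have the
same colour. -/
theorem exists_monochromatic_chain {K : Type} [Finite K] (P : K → ℕ → ℕ → Prop)
    (h : ∀ i j, i < j → ∃ c, P c i j) : ∃ c i j l, i < j ∧ j < l ∧ P c i j ∧ P c j l := by
  -- Pigeonhole on the set of colours that leave an index: if `i < j` have the same set, the colour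
  -- of `(i, j)` also leaves `j`.
  obtain ⟨i, j, hij, he⟩ :=
    Finite.exists_ne_map_eq_of_infinite (fun i => {c : K | ∃ l, i < l ∧ P c i l})
  wlog hlt : i < j generalizing i j
  · exact this j i hij.symm he.symm (by omega)
  obtain ⟨c, hc⟩ := h i j hlt
  have : c ∈ {c : K | ∃ l, j < l ∧ P c j l} := by
    rw [← he]
    exact ⟨j, hlt, hc⟩
  obtain ⟨l, hjl, hcl⟩ := this
  exact ⟨c, i, j, l, hlt, hjl, hc, hcl⟩

/-- `n` zeros on the input tape. -/
def zeros (n : ℕ) : List (Tape PalSym) := List.replicate n (Tape.sym (PalSym.bit false))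

theorem zeros_add (m n : ℕ) : zeros (m + n) = zeros m ++ zeros n :=
  List.replicate_add ..

theorem eq_zeros_of_append_eq {u v : List (Tape PalSym)} {n : ℕ} (h : zeros n = u ++ v) :
    u = zeros u.length ∧ v = zeros v.length := by
  have := List.append_eq_replicate_iff.1 h.symm
  exact ⟨this.2.1, this.2.2⟩

/-- A prefix and a suffix of two words from `p 0* s`, cut at comparable places, recombine to a
word from `p 0* s`. -/
theorem exists_append_eq_block {p s u₁ u₂ v₁ v₂ : List (Tape PalSym)} {m n : ℕ}
    (hu : p ++ zeros m ++ s = u₁ ++ u₂) (hv : p ++ zeros n ++ s = v₁ ++ v₂)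
    (h₁ : min u₁.length p.length = min v₁.length p.length)
    (h₂ : min u₂.length s.length = min v₂.length s.length) :
    ∃ k, u₁ ++ v₂ = p ++ zeros k ++ s := by
  -- If either cut falls inside the fixed prefix or suffix, both cuts are at the same place there,
  -- and the recombined word is one of the two given words.
  by_cases hp : u₁.length < p.length
  · have hl : v₁.length = u₁.length := by omega
    refine ⟨n, ?_⟩
    rw [hv]
    congr 1
    have e₁ := congrArg (List.take u₁.length) hu
    have e₂ := congrArg (List.take u₁.length) hv
    rw [List.append_assoc, List.take_append_of_le_length hp.le, List.take_left' rfl] at e₁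
    rw [List.append_assoc, List.take_append_of_le_length hp.le, List.take_left' hl] at e₂
    exact e₁.symm.trans e₂
  by_cases hs : u₂.length < s.length
  · have hl : v₂.length = u₂.length := by omega
    refine ⟨m, ?_⟩
    rw [hu]
    congr 1
    obtain ⟨s₁, rfl⟩ : u₂ <:+ s :=
      List.suffix_of_suffix_length_le ⟨u₁, hu.symm⟩ ⟨_, rfl⟩ hs.le
    rw [← List.append_assoc] at hu hv
    rw [(List.append_inj' hv hl.symm).2]
  -- Now both cuts fall within the zeros, and only the number of zeros changes.
  obtain ⟨w₁, rfl⟩ : p <+: u₁ :=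
    List.prefix_of_prefix_length_le ⟨zeros m ++ s, by rw [← List.append_assoc, hu]⟩
      (List.prefix_append u₁ u₂) (by omega)
  obtain ⟨w₂, rfl⟩ : s <:+ u₂ :=
    List.suffix_of_suffix_length_le ⟨p ++ zeros m, hu⟩ ⟨_, rfl⟩ (by omega)
  obtain ⟨x₁, rfl⟩ : p <+: v₁ :=
    List.prefix_of_prefix_length_le ⟨zeros n ++ s, by rw [← List.append_assoc, hv]⟩
      (List.prefix_append v₁ v₂) (by omega)
  obtain ⟨x₂, rfl⟩ : s <:+ v₂ :=
    List.suffix_of_suffix_length_le ⟨p ++ zeros n, hv⟩ ⟨_, rfl⟩ (by omega)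
  have hu' : zeros m = w₁ ++ w₂ := by
    rw [← List.append_assoc (p ++ w₁), List.append_cancel_right_eq, List.append_assoc] at hu
    exact List.append_cancel_left hu
  have hv' : zeros n = x₁ ++ x₂ := by
    rw [← List.append_assoc (p ++ x₁), List.append_cancel_right_eq, List.append_assoc] at hv
    exact List.append_cancel_left hv
  refine ⟨w₁.length + x₂.length, ?_⟩
  rw [zeros_add, ← (eq_zeros_of_append_eq hu').1, ← (eq_zeros_of_append_eq hv').2]
  simp

/-- The word `0^a ♮ 0^b ♮ # 0^c ♮ 0^d ♮`. -/
def zeroWord (a b c d : ℕ) : List PalSym :=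
  bits (List.replicate a false) ++ [PalSym.nat] ++ bits (List.replicate b false) ++
    [PalSym.nat] ++ bits [] ++ [PalSym.hash] ++ bits (List.replicate c false) ++ [PalSym.nat] ++
    bits (List.replicate d false) ++ [PalSym.nat] ++ bits []

/-- The part of the tape of a `zeroWord` up to the end of its first block, with the separator
after it. -/
def tapeA (a : ℕ) : List (Tape PalSym) := [.left] ++ zeros a ++ [.sym .nat]

/-- The second block of the tape of a `zeroWord`, with the separator after it. -/
def tapeB (b : ℕ) : List (Tape PalSym) := [] ++ zeros b ++ [.sym .nat]

/-- The end of the tape of a `zeroWord`, from the separator before its last nonempty block. -/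
def tapeD (d : ℕ) : List (Tape PalSym) := [.sym .nat] ++ zeros d ++ [.sym .nat, .right]

theorem tapeOf_zeroWord (a b c d : ℕ) : tapeOf (zeroWord a b c d) =
    tapeA a ++ (tapeB b ++ .sym .hash :: (zeros c ++ tapeD d)) := by
  simp [tapeOf, zeroWord, tapeA, tapeB, tapeD, zeros, bits]

theorem bits_append_cons_inj {x x' : List Bool} {c c' : PalSym} {r r' : List PalSym}
    (hc : ∀ b, c ≠ .bit b) (hc' : ∀ b, c' ≠ .bit b)
    (h : bits x ++ c :: r = bits x' ++ c' :: r') : x = x' ∧ r = r' := by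
  induction x generalizing x' with
  | nil =>
    cases x' with
    | nil => simpa [bits] using (List.cons.inj h).2
    | cons b x' => exact absurd (List.cons.inj h).1 (hc b)
  | cons b x ih =>
    cases x' with
    | nil => exact absurd (List.cons.inj h).1.symm (hc' b)
    | cons b' x' =>
      have h' := List.cons.inj h
      obtain ⟨rfl, rfl⟩ := ih h'.2
      have : b = b' := PalSym.bit.inj h'.1
      simp [this]

theorem bits_injective : Function.Injective bits :=
  List.map_injective_iff.2 fun _ _ h => PalSym.bit.inj h

/-- The separators make the decomposition unique. The third blocks are both empty and contribute
only `[]`, so two pairs of blocks carry the whole argument. -/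
theorem palPairs_zeroWord {i l : ℕ} (h : i ≠ l) : palPairs (zeroWord i i l l) = {[]} := by
  refine Set.Subset.antisymm ?_ (by simp [palPairs])
  rintro s (hs | ⟨x, y, hw, k, hk, rfl⟩)
  · exact hs
  · simp only [zeroWord, List.append_assoc, List.singleton_append] at hw
    obtain ⟨h₁, hw⟩ := bits_append_cons_inj (by simp) (by simp) hw
    obtain ⟨h₂, hw⟩ := bits_append_cons_inj (by simp) (by simp) hw
    obtain ⟨h₃, hw⟩ := bits_append_cons_inj (by simp) (by simp) hw
    obtain ⟨h₄, hw⟩ := bits_append_cons_inj (by simp) (by simp) hw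
    obtain ⟨h₅, hw⟩ := bits_append_cons_inj (by simp) (by simp) hw
    have h₆ := bits_injective hw
    have hk' := congrArg List.length hk
    fin_cases k
    · simp [← h₁, ← h₄, h] at hk'
    · simp [← h₂, ← h₅, h] at hk'
    · simp [← h₃, ← h₆]

theorem zeros_mem_palPairs_fst (a b d : ℕ) :
    List.replicate (a + a) false ∈ palPairs (zeroWord a b a d) := by
  refine .inr ⟨![List.replicate a false, List.replicate b false, []],
    ![List.replicate a false, List.replicate d false, []], rfl, 0, ?_, ?_⟩
  · simp
  · simp

theorem zeros_mem_palPairs_snd (a b c : ℕ) :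
    List.replicate (b + b) false ∈ palPairs (zeroWord a b c b) := by
  refine .inr ⟨![List.replicate a false, List.replicate b false, []],
    ![List.replicate c false, List.replicate b false, []], rfl, 1, ?_, ?_⟩
  · simp
  · simp

theorem palPairs_zeroWord_fst_ne {a : ℕ} (ha : a ≠ 0) (b d : ℕ) :
    palPairs (zeroWord a b a d) ≠ {[]} := fun h => by
  have h' := zeros_mem_palPairs_fst a b d
  rw [h] at h'
  simp [ha] at h'

theorem palPairs_zeroWord_snd_ne {b : ℕ} (hb : b ≠ 0) (a c : ℕ) :
    palPairs (zeroWord a b c b) ≠ {[]} := fun h => by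
  have h' := zeros_mem_palPairs_snd a b c
  rw [h] at h'
  simp [hb] at h'

/-! ### Cutting and recombining silent accepting runs -/

namespace NPDA

variable {G : Type} (M : NPDA PalSym G)

/-- A silent accepting run on `zeroWord i i l l` in which a segment from the first block of the
left half to the first block of the right half starts with `w` on top of the stack, which it
pops. -/
def CutAcross (s : M.Q) (w : List M.Stk) (p : M.Q) (m₁ m₂ i l : ℕ) : Prop :=
  ∃ A₁ A₂ C₁ C₂ D₁ D₂ δ f γ, tapeA i = A₁ ++ A₂ ∧ zeros l = C₁ ++ C₂ ∧
    tapeD l = D₁ ++ D₂ ∧ min A₁.length 1 = m₁ ∧ min A₂.length 1 = m₂ ∧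
    M.Silent M.start [M.bottom] A₁ s (w ++ δ) ∧
    M.Silent s w (A₂ ++ (tapeB i ++ .sym .hash :: C₁)) p [] ∧
    M.Silent p δ (C₂ ++ D₁) f γ ∧ f ∈ M.acc

/-- A silent accepting run on `zeroWord i i l l` in which a segment from the second block of the
left half to the end of the first block of the right half or later starts with `Z` on top of the
stack, which it pops. -/
def CutRight (p : M.Q) (Z : M.Stk) (r : M.Q) (m₁ m₂ m₃ i l : ℕ) : Prop :=
  ∃ B₁ B₂ D₁ D₂ D₃ β f γ, tapeB i = B₁ ++ B₂ ∧ tapeD l = D₁ ++ (D₂ ++ D₃) ∧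
    min B₂.length 1 = m₁ ∧ min D₁.length 1 = m₂ ∧ min (D₂ ++ D₃).length 2 = m₃ ∧
    M.Silent M.start [M.bottom] (tapeA i ++ B₁) p (Z :: β) ∧
    M.Silent p [Z] (B₂ ++ .sym .hash :: (zeros l ++ D₁)) r [] ∧
    M.Silent r β D₂ f γ ∧ f ∈ M.acc

/-- As `CutRight`, but `Z` is not popped. -/
def CutEnd (p : M.Q) (Z : M.Stk) (m i l : ℕ) : Prop :=
  ∃ B₁ B₂ D₁ D₂ β f γ, tapeB i = B₁ ++ B₂ ∧ tapeD l = D₁ ++ D₂ ∧ min B₂.length 1 = m ∧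
    M.Silent M.start [M.bottom] (tapeA i ++ B₁) p (Z :: β) ∧
    M.Silent p [Z] (B₂ ++ .sym .hash :: (zeros l ++ D₁)) f γ ∧ f ∈ M.acc

variable {M}

theorem nil_mem_outputs_of_silent {x : List PalSym} {u v : List (Tape PalSym)} {f : M.Q}
    {γ : List M.Stk} (h : M.Silent M.start [M.bottom] u f γ) (hf : f ∈ M.acc)
    (hx : tapeOf x = u ++ v) : [] ∈ M.outputs x :=
  nil_mem_outputs_iff.2 ⟨u, v, f, γ, hx, h, hf⟩

/-- The transplanted segment contains the whole second left block, of length `i'`, while the second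
right block, of length `l`, stays outside. The cuts go through the first blocks, whose new lengths
`a` and `c` are uncontrolled. -/
theorem CutAcross.swap {s : M.Q} {w : List M.Stk} {p : M.Q} {m₁ m₂ i l i' l' : ℕ}
    (h : M.CutAcross s w p m₁ m₂ i l) (h' : M.CutAcross s w p m₁ m₂ i' l') :
    ∃ a c, [] ∈ M.outputs (zeroWord a i' c l) := by
  obtain ⟨A₁, A₂, C₁, C₂, D₁, D₂, δ, f, γ, hA, hC, hD, hm₁, hm₂, h₁, -, h₃, hf⟩ := h
  obtain ⟨A₁', A₂', C₁', C₂', D₁', D₂', δ', f', γ', hA', hC', -, hm₁', hm₂', -, h₂', -, -⟩ := h'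
  obtain ⟨a, ha⟩ := exists_append_eq_block hA hA' (by simpa using hm₁.trans hm₁'.symm)
    (by simpa using hm₂.trans hm₂'.symm)
  refine ⟨a, C₁'.length + C₂.length,
    nil_mem_outputs_of_silent (v := D₂) ((h₁.trans (h₂'.frame δ)).trans h₃) hf ?_⟩
  rw [tapeOf_zeroWord, hD, tapeA, ← ha, zeros_add, ← (eq_zeros_of_append_eq hC').1,
    ← (eq_zeros_of_append_eq hC).2]
  simp

/-- Here the transplanted segment contains the whole first right block, of length `l'`, while the
first left block, of length `i`, stays outside. The cuts go through the second blocks. -/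
theorem CutRight.swap {p : M.Q} {Z : M.Stk} {r : M.Q} {m₁ m₂ m₃ i l i' l' : ℕ}
    (h : M.CutRight p Z r m₁ m₂ m₃ i l) (h' : M.CutRight p Z r m₁ m₂ m₃ i' l') :
    ∃ b d, [] ∈ M.outputs (zeroWord i b l' d) := by
  obtain ⟨B₁, B₂, D₁, D₂, D₃, β, f, γ, hB, hD, hm₁, hm₂, hm₃, h₁, -, h₃, hf⟩ := h
  obtain ⟨B₁', B₂', D₁', D₂', D₃', β', f', γ', hB', hD', hm₁', hm₂', hm₃', -, h₂', -, -⟩ := h'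
  obtain ⟨b, hb⟩ := exists_append_eq_block hB hB' (by simp) (by simpa using hm₁.trans hm₁'.symm)
  obtain ⟨d, hd⟩ := exists_append_eq_block hD' hD (by simpa using hm₂'.trans hm₂.symm)
    (by simpa using hm₃'.trans hm₃.symm)
  refine ⟨b, d, nil_mem_outputs_of_silent (v := D₃) ((h₁.trans (h₂'.frame β)).trans h₃) hf ?_⟩
  rw [tapeOf_zeroWord, tapeB, ← hb, tapeD, ← hd]
  simp

/-- Acceptance happens without touching the stack below `Z`, so everything after the cut in the
second left block is taken from the second run. -/
theorem CutEnd.swap {p : M.Q} {Z : M.Stk} {m i l i' l' : ℕ}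
    (h : M.CutEnd p Z m i l) (h' : M.CutEnd p Z m i' l') :
    ∃ b d, [] ∈ M.outputs (zeroWord i b l' d) := by
  obtain ⟨B₁, B₂, D₁, D₂, β, f, γ, hB, hD, hm, h₁, -, hf⟩ := h
  obtain ⟨B₁', B₂', D₁', D₂', β', f', γ', hB', hD', hm', -, h₂', hf'⟩ := h'
  obtain ⟨b, hb⟩ := exists_append_eq_block hB hB' (by simp) (by simpa using hm.trans hm'.symm)
  refine ⟨b, l', nil_mem_outputs_of_silent (v := D₂') (h₁.trans (h₂'.frame β)) hf' ?_⟩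
  rw [tapeOf_zeroWord, tapeB, ← hb, hD']
  simp

/-- The two sides of `#` at which the stack can be lowest give the alternatives; the second one
splits according to whether the stack above the low point is popped later. The assumption on
`zeroWord i i l i` forces the run to read beyond the first right block. -/
theorem exists_cut {L : ℕ} (hL : ∀ q a Z, ∀ r ∈ M.trans q a Z, r.2.1.length ≤ L) (hL1 : 1 ≤ L)
    {i l : ℕ} (h : [] ∈ M.outputs (zeroWord i i l l)) (h' : [] ∉ M.outputs (zeroWord i i l i)) :
    (∃ s w p m₁ m₂, w.length ≤ L ∧ m₁ < 2 ∧ m₂ < 2 ∧ M.CutAcross s w p m₁ m₂ i l) ∨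
      (∃ p Z r m₁ m₂ m₃, m₁ < 2 ∧ m₂ < 2 ∧ m₃ < 3 ∧ M.CutRight p Z r m₁ m₂ m₃ i l) ∨
      ∃ p Z m, m < 2 ∧ M.CutEnd p Z m i l := by
  obtain ⟨u, v, f, γ, hu, hs, hf⟩ := nil_mem_outputs_iff.1 h
  rw [tapeOf_zeroWord] at hu
  replace hu : (tapeA i ++ (tapeB i ++ .sym .hash :: zeros l)) ++ tapeD l = u ++ v := by
    simpa using hu
  rcases List.append_eq_append_iff.1 hu with ⟨D₁, rfl, hD⟩ | ⟨v', hv', rfl⟩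
  swap
  -- A run that stops before `tapeD l` never sees the last block, so it also accepts with that block
  -- changed to length `i`.
  · refine absurd (nil_mem_outputs_of_silent (v := v' ++ tapeD i) hs hf ?_) h'
    rw [tapeOf_zeroWord, ← List.append_assoc u, ← hv']
    simp
  rcases eq_or_ne D₁ [] with rfl | hne
  · refine absurd (nil_mem_outputs_of_silent (v := tapeD i) hs hf ?_) h'
    rw [tapeOf_zeroWord]
    simp
  obtain ⟨q₃, γ₃, hs, h₃⟩ := hs.split _ _ rfl
  obtain ⟨q₁, γ₁, h₁, h₂⟩ := hs.split _ _ rfl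
  -- The low point is taken over the second left block, `#` and the first right block. The stack is
  -- nonempty afterwards, since the run still reads a symbol.
  obtain ⟨u₁, u₂, p, α, Z, β, α', he, rfl, rfl, hp, hZ⟩ :=
    h₂.low_point (h₃.nonempty_of_read hne)
  have key : (∃ C₁, u₁ = tapeB i ++ .sym .hash :: C₁ ∧ zeros l = C₁ ++ u₂) ∨
      ∃ B₂, tapeB i = u₁ ++ B₂ ∧ u₂ = B₂ ++ .sym .hash :: zeros l := by
    rcases List.append_eq_append_iff.1 he with ⟨w, rfl, hw⟩ | ⟨w, hw, rfl⟩
    · rcases w with _ | ⟨c, w⟩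
      · exact .inr ⟨[], by simp, by simpa using hw.symm⟩
      · simp only [List.cons_append, List.cons.injEq] at hw
        obtain ⟨rfl, hw⟩ := hw
        exact .inl ⟨w, rfl, hw⟩
    · exact .inr ⟨w, hw, rfl⟩
  rcases key with ⟨C₁, rfl, hC⟩ | ⟨B₂, hB, rfl⟩
  · left
    -- The string `α` popped across `#` may be long. Going back to the moment when its lowest part
    -- was pushed replaces it by a string of length at most `L`.
    have hpush : ∃ A₁ A₂ s w, tapeA i = A₁ ++ A₂ ∧ w.length ≤ L ∧
        M.Silent M.start [M.bottom] A₁ s (w ++ Z :: β) ∧ M.Silent s w A₂ q₁ α := by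
      rcases h₁.last_push hL α (Z :: β) rfl with ⟨w, hw, h⟩ | h
      -- If `α` goes back to the initial stack, `w` is part of `[M.bottom]`; this is where `1 ≤ L`
      -- is needed.
      · refine ⟨[], tapeA i, M.start, w, rfl, ?_, ?_, h⟩
        · have := congrArg List.length hw
          simp at this
          omega
        · rw [hw]
          exact .refl _ _
      · exact h
    obtain ⟨A₁, A₂, s, w, hA, hw, hs₁, hs₂⟩ := hpush
    exact ⟨s, w, p, _, _, hw, by omega, by omega, A₁, A₂, C₁, u₂, D₁, v, Z :: β, f, γ, hA, hC, hD,
      rfl, rfl, hs₁, hs₂.trans hp, (hZ.frame β).trans h₃, hf⟩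
  · right
    have hpre := h₁.trans (hp.frame (Z :: β))
    rcases h₃.pop_or_stay α' β rfl with ⟨D', D'', r, rfl, hr, hr'⟩ | ⟨δ, hδ, -⟩
    · refine .inl ⟨p, Z, r, _, _, _, ?_, ?_, ?_, u₁, B₂, D', D'', v, β, f, γ, hB,
        by simpa using hD, rfl, rfl, rfl, hpre, by simpa using hZ.trans hr, hr', hf⟩ <;> omega
    · exact .inr ⟨p, Z, _, by omega, u₁, B₂, D₁, v, β, f, δ, hB, hD, rfl, hpre,
        by simpa using hZ.trans hδ, hf⟩

/-- Termination plays no role: the words with `palPairs w = {[]}` cannot be recognized by silent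
runs of any npda. -/
theorem not_nil_mem_outputs_iff (M : NPDA PalSym G) :
    ¬ ∀ w, [] ∈ M.outputs w ↔ palPairs w = {[]} := by
  intro hM
  have : Finite PalSym := PalSym.finite
  have := M.finQ
  have := M.finStk
  obtain ⟨L, hL⟩ := M.exists_push_bound
  have hL' : ∀ q a Z, ∀ r ∈ M.trans q a Z, r.2.1.length ≤ L + 1 :=
    fun q a Z r hr => (hL q a Z r hr).trans (Nat.le_succ L)
  have : Finite {w : List M.Stk // w.length ≤ L + 1} := List.finite_length_le _ _
  -- The colours are the boundary data of the three kinds of cut. The shift to `i + 1` and `l + 1`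
  -- makes all four blocks nonempty, so that a match yields a nonempty pair.
  let P : (M.Q × {w : List M.Stk // w.length ≤ L + 1} × M.Q × Fin 2 × Fin 2) ⊕
      (M.Q × M.Stk × M.Q × Fin 2 × Fin 2 × Fin 3) ⊕ (M.Q × M.Stk × Fin 2) → ℕ → ℕ → Prop
    | .inl (s, w, p, m₁, m₂), i, l => M.CutAcross s w p m₁ m₂ (i + 1) (l + 1)
    | .inr (.inl (p, Z, r, m₁, m₂, m₃)), i, l => M.CutRight p Z r m₁ m₂ m₃ (i + 1) (l + 1)
    | .inr (.inr (p, Z, m)), i, l => M.CutEnd p Z m (i + 1) (l + 1)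
  obtain ⟨c, i, j, l, -, -, hij, hjl⟩ := exists_monochromatic_chain P fun i l hil => by
    have h := palPairs_zeroWord (i := i + 1) (l := l + 1) (by omega)
    have h' := palPairs_zeroWord_snd_ne (b := i + 1) (by omega) (i + 1) (l + 1)
    rw [← hM] at h
    rw [Ne, ← hM] at h'
    rcases M.exists_cut hL' (by omega) h h' with ⟨s, w, p, m₁, m₂, hw, hm₁, hm₂, hc⟩ |
      ⟨p, Z, r, m₁, m₂, m₃, hm₁, hm₂, hm₃, hc⟩ | ⟨p, Z, m, hm, hc⟩
    · exact ⟨.inl (s, ⟨w, hw⟩, p, ⟨m₁, hm₁⟩, ⟨m₂, hm₂⟩), hc⟩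
    · exact ⟨.inr (.inl (p, Z, r, ⟨m₁, hm₁⟩, ⟨m₂, hm₂⟩, ⟨m₃, hm₃⟩)), hc⟩
    · exact ⟨.inr (.inr (p, Z, ⟨m, hm⟩)), hc⟩
  rcases c with ⟨s, w, p, m₁, m₂⟩ | ⟨p, Z, r, m₁, m₂, m₃⟩ | ⟨p, Z, m⟩
  -- The segment of the run for `(j, l)` goes into the run for `(i, j)`: both second blocks get
  -- length `j + 1`.
  · obtain ⟨a, c, h⟩ := CutAcross.swap hij hjl
    rw [hM] at h
    exact palPairs_zeroWord_snd_ne (by omega) _ _ h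
  -- The roles are reversed: the segment of the run for `(i, j)` goes into the run for `(j, l)`, and
  -- both first blocks get length `j + 1`.
  · obtain ⟨a, c, h⟩ := CutRight.swap hjl hij
    rw [hM] at h
    exact palPairs_zeroWord_fst_ne (by omega) _ _ h
  · obtain ⟨a, c, h⟩ := CutEnd.swap hjl hij
    rw [hM] at h
    exact palPairs_zeroWord_fst_ne (by omega) _ _ h

end NPDA

/-- Nothing precedes `[]` in dictionary order, so it is a maximum only of `{[]}`. -/
theorem nil_mem_maxPalPair_iff {w : List PalSym} :
    [] ∈ maxPalPair.val w ↔ palPairs w = {[]} := by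
  constructor
  · rintro ⟨h, h'⟩
    refine Set.Subset.antisymm (fun z hz => ?_) (Set.singleton_subset_iff.2 h)
    rcases h' z hz with h | h
    · exact h
    · cases h
  · intro h
    change IsDictMax _ _ _
    rw [h]
    exact ⟨rfl, fun z hz => .inl hz⟩

theorem maxPalPair_notMem_CFLSVt : maxPalPair ∉ CFLSVt := by
  rintro ⟨⟨⟨M, -, hM⟩, -⟩, -⟩
  refine NPDA.not_nil_mem_outputs_iff M fun w => ?_
  rw [← nil_mem_maxPalPair_iff]
  exact (Set.ext_iff.1 (hM w) []).symm

end CFLFun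

namespace CFLFun

/-! ### The separating function is the maximum of an npda -/

/-- States of the npda computing `palPairs`: `scan i k` means that block `i` of the left half is to
be compared with block `i` of the right half, and block `k` of the input is being read. -/
inductive PalState : Type
  | start : PalState
  | scan (i : Fin 3) (k : Fin 6) : PalState
  | accept : PalState
  | reject : PalState

instance PalState.finite : Finite PalState := by
  refine Finite.of_injective (fun s : PalState => match s with
      | .start => (.inl 0 : Fin 3 ⊕ (Fin 3 × Fin 6))
      | .accept => .inl 1
      | .reject => .inl 2
      | .scan i k => .inr (i, k)) ?_
  intro s t h
  cases s <;> cases t <;> simp_all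

/-- The move of the scanning npda on a symbol: new block, string replacing the topmost stack
symbol (where `none` is the bottom symbol), output. -/
def palMove (i : Fin 3) (k : Fin 6) (Z : Option Bool) :
    PalSym → Option (Fin 6 × List (Option Bool) × Option Bool)
  | .bit b =>
    if k.1 = i.1 then some (k, [some b, Z], some b)
    else if k.1 = i.1 + 3 then (if Z = some b then some (k, [], some b) else none)
    else some (k, [Z], none)
  -- Block 5 is the last one, so a separator after it is refused and `k + 1` never wraps around in
  -- `Fin 6`.
  | .nat =>
    if k.1 = 2 ∨ k.1 = 5 ∨ (k.1 = i.1 + 3 ∧ Z ≠ none) then none else some (k + 1, [Z], none)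
  | .hash => if k.1 = 2 then some (k + 1, [Z], none) else none

/-- Moves of the npda computing `palPairs`. -/
def palTrans : PalState → Option (Tape PalSym) → Option Bool →
    Set (PalState × List (Option Bool) × Option Bool)
  | .start, none, Z => {(.accept, [Z], none)}
  | .start, some .left, Z => Set.range fun i => (.scan i 0, [Z], none)
  | .scan i k, some (.sym a), Z =>
    match palMove i k Z a with
    | some (k', w, o) => {(.scan i k', w, o)}
    | none => {(.reject, [Z], none)}
  | .scan i k, some .right, Z =>
    if k.1 = 5 ∧ (k.1 = i.1 + 3 → Z = none) then {(.accept, [Z], none)} else {(.reject, [Z], none)}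
  | _, _, _ => ∅

/-- An npda computing `palPairs`. -/
abbrev palNPDA : NPDA PalSym Bool where
  Q := PalState
  Stk := Option Bool
  finQ := inferInstance
  finStk := inferInstance
  start := .start
  bottom := none
  acc := {.accept}
  rej := {.reject}
  disj := by simp
  trans := palTrans
  finTrans q a Z := by
    unfold palTrans
    split
    · exact Set.finite_singleton _
    · exact Set.finite_range _
    · split <;> exact Set.finite_singleton _
    · split <;> exact Set.finite_singleton _
    · exact Set.finite_empty

/-- The stack with content `st` above the bottom symbol. -/
def palStack (st : List Bool) : List (Option Bool) := st.map some ++ [none]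

/-- The output of the scanning npda on the rest `u` of the input, with `st` on the stack. -/
def palRun (i : Fin 3) : Fin 6 → List Bool → List PalSym → Option (List Bool)
  | k, st, [] => if k.1 = 5 ∧ (k.1 = i.1 + 3 → st = []) then some [] else none
  | k, st, .bit b :: u =>
    if k.1 = i.1 then (palRun i k (b :: st) u).map (b :: ·)
    else if k.1 = i.1 + 3 then
      (if st.head? = some b then (palRun i k st.tail u).map (b :: ·) else none)
    else palRun i k st u
  | k, st, .nat :: u =>
    if k.1 = 2 ∨ k.1 = 5 ∨ (k.1 = i.1 + 3 ∧ st ≠ []) then none else palRun i (k + 1) st u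
  | k, st, .hash :: u => if k.1 = 2 then palRun i (k + 1) st u else none

/-- What is known after `n` steps on input `x`. -/
inductive PalInv (x : List PalSym) : ℕ → palNPDA.Config → Prop
  | init : PalInv x 0 (palNPDA.init x)
  | scan {n : ℕ} {i : Fin 3} {k : Fin 6} {u : List PalSym} {st y : List Bool} :
      n + u.length = x.length + 1 →
      (∀ s, palRun i k st u = some s → palRun i 0 [] x = some (y ++ s)) →
      PalInv x n ⟨PalState.scan i k, u.map Tape.sym ++ [Tape.right], palStack st, y⟩
  | accept {n : ℕ} {u : List (Tape PalSym)} {v : List (Option Bool)} {y : List Bool} :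
      n ≤ x.length + 2 → (y = [] ∨ ∃ i, palRun i 0 [] x = some y) →
      PalInv x n ⟨PalState.accept, u, v, y⟩
  | reject {n : ℕ} {u : List (Tape PalSym)} {v : List (Option Bool)} {y : List Bool} :
      n ≤ x.length + 2 → PalInv x n ⟨PalState.reject, u, v, y⟩

theorem palStack_cases (st : List Bool) : ∃ Z v, palStack st = Z :: v ∧ Z = st.head? ∧
    (Z ≠ none → v = palStack st.tail) := by
  cases st with
  | nil => exact ⟨none, [], rfl, rfl, by simp⟩
  | cons b st => exact ⟨some b, palStack st, rfl, rfl, by simp⟩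

/-- `palMove` and `palRun` agree. -/
theorem palMove_spec (i : Fin 3) (k : Fin 6) (a : PalSym) (u : List PalSym) (st : List Bool)
    {Z : Option Bool} {v : List (Option Bool)} (hZ : palStack st = Z :: v) :
    (palMove i k Z a = none ∧ palRun i k st (a :: u) = none) ∨
    ∃ k' w o st', palMove i k Z a = some (k', w, o) ∧ w ++ v = palStack st' ∧
      palRun i k st (a :: u) = (palRun i k' st' u).map (o.toList ++ ·) := by
  obtain ⟨Z', v', h, hZ', hv⟩ := palStack_cases st
  rw [hZ] at h
  obtain ⟨rfl, rfl⟩ := List.cons.inj h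
  have hnil : Z ≠ none ↔ st ≠ [] := by simp [hZ']
  cases a with
  | bit b =>
    simp only [palMove, palRun]
    split_ifs with h₁ h₂ h₃ h₄ h₅
    · exact .inr ⟨_, _, _, b :: st, rfl, by simp [palStack, ← hZ], by simp⟩
    · exact .inr ⟨_, _, _, st.tail, rfl, by simp [hv (by simp [h₃])], by simp⟩
    · exact absurd (hZ'.symm.trans h₃) h₄
    · exact absurd (hZ'.trans h₅) h₃
    · exact .inl ⟨rfl, rfl⟩
    · exact .inr ⟨_, _, _, st, rfl, by simp [hZ], by simp⟩
  | nat =>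
    simp only [palMove, palRun, hnil]
    split_ifs with h₁
    · exact .inl ⟨rfl, rfl⟩
    · exact .inr ⟨_, _, _, st, rfl, by simp [hZ], by simp⟩
  | hash =>
    simp only [palMove, palRun]
    split_ifs with h₁
    · exact .inr ⟨_, _, _, st, rfl, by simp [hZ], by simp⟩
    · exact .inl ⟨rfl, rfl⟩

theorem palTrans_sym_none {i : Fin 3} {k : Fin 6} {Z : Option Bool} {a : PalSym}
    (h : palMove i k Z a = none) :
    palTrans (.scan i k) (some (.sym a)) Z = {(.reject, [Z], none)} := by
  simp [palTrans, h]

theorem palTrans_sym_some {i : Fin 3} {k k' : Fin 6} {Z : Option Bool} {a : PalSym}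
    {w : List (Option Bool)} {o : Option Bool} (h : palMove i k Z a = some (k', w, o)) :
    palTrans (.scan i k) (some (.sym a)) Z = {(.scan i k', w, o)} := by
  simp [palTrans, h]

theorem PalInv.step {x : List PalSym} {n : ℕ} {c c' : palNPDA.Config} (h : PalInv x n c)
    (hs : palNPDA.Step c c') : PalInv x (n + 1) c' := by
  cases h with
  | init =>
    obtain ⟨-, a, u', Z, v, p, w, o, hu, hγ, ht, rfl⟩ := hs.inv
    change (p, w, o) ∈ palTrans .start a Z at ht
    obtain ⟨rfl, rfl⟩ := List.cons.inj hγ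
    rcases a with _ | _ | a | _
    · cases (show (p, w, o) = (.accept, [none], none) from ht)
      exact .accept (by omega) (.inl rfl)
    · obtain ⟨i, hi⟩ := ht
      cases hi
      obtain rfl : _ = u' := (List.cons.inj hu).2
      exact .scan (st := []) (y := []) (by omega) fun s hs => hs
    · exact ht.elim
    · exact ht.elim
  | @scan n i k u st y hn hr =>
    obtain ⟨-, a, u', Z, v, p, w, o, hu, hγ, ht, rfl⟩ := hs.inv
    change (p, w, o) ∈ palTrans (.scan i k) a Z at ht
    rcases a with _ | _ | a | _
    · exact ht.elim
    · exact ht.elim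
    · rcases u with _ | ⟨b, u⟩
      · simp at hu
      · simp only [List.map_cons, List.cons_append, Option.toList_some, List.nil_append,
          List.cons.injEq, Tape.sym.injEq] at hu
        obtain ⟨rfl, rfl⟩ := hu
        rw [List.length_cons] at hn
        rcases palMove_spec i k b u st hγ with ⟨h₁, -⟩ | ⟨k', w', o', st', h₁, h₂, h₃⟩
        · rw [palTrans_sym_none h₁] at ht
          cases (Set.mem_singleton_iff.1 ht)
          exact .reject (by omega)
        · rw [palTrans_sym_some h₁] at ht
          cases (Set.mem_singleton_iff.1 ht)
          rw [h₂]
          refine .scan (by omega) fun s hs => ?_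
          have := hr (o.toList ++ s) (by rw [h₃, hs]; rfl)
          simpa using this
    · rcases u with _ | ⟨b, u⟩
      · simp only [palTrans] at ht
        simp only [List.length_nil] at hn
        obtain ⟨Z', v', hZ, hZ', -⟩ := palStack_cases st
        rw [hγ] at hZ
        obtain ⟨rfl, rfl⟩ := List.cons.inj hZ
        split_ifs at ht with hk
        · cases (Set.mem_singleton_iff.1 ht)
          have := hr [] (by
            simp only [palRun]
            rw [if_pos]
            simpa [hZ'] using hk)
          exact .accept (by omega) (.inr ⟨i, by simpa using this⟩)
        · cases (Set.mem_singleton_iff.1 ht)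
          exact .reject (by omega)
      · simp at hu
  | accept => exact absurd (Or.inl rfl) hs.inv.1
  | reject => exact absurd (Or.inr rfl) hs.inv.1

theorem palInv {x : List PalSym} {n : ℕ} {c : palNPDA.Config}
    (h : StepsIn palNPDA.Step (palNPDA.init x) n c) : PalInv x n c := by
  induction h with
  | refl => exact .init
  | tail _ hs ih => exact ih.step hs

theorem PalState.scan_notMem_halt (i : Fin 3) (k : Fin 6) :
    (PalState.scan i k : palNPDA.Q) ∉ palNPDA.halt := by
  rintro (h | h) <;> cases h

theorem PalState.start_notMem_halt : (PalState.start : palNPDA.Q) ∉ palNPDA.halt := by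
  rintro (h | h) <;> cases h

theorem palNPDA_terminates : palNPDA.Terminates := by
  refine ⟨1, 2, fun x n c h => ?_⟩
  cases palInv h with
  | init =>
    refine ⟨by omega, .inr ⟨_, NPDA.Step.stay PalState.start_notMem_halt
      (p := PalState.accept) (w := [none]) (o := none) (Set.mem_singleton _)⟩⟩
  | @scan n i k u st y hn hr =>
    refine ⟨by omega, .inr ?_⟩
    obtain ⟨Z, v, hγ, -⟩ := palStack_cases st
    rw [hγ]
    rcases u with _ | ⟨b, u⟩
    · have : (palTrans (.scan i k) (some .right) Z).Nonempty := by
        simp only [palTrans]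
        split_ifs <;> exact Set.singleton_nonempty _
      obtain ⟨⟨p, w, o⟩, hp⟩ := this
      exact ⟨_, NPDA.Step.read (PalState.scan_notMem_halt i k) hp⟩
    · have : (palTrans (.scan i k) (some (.sym b)) Z).Nonempty := by
        simp only [palTrans]
        split <;> exact Set.singleton_nonempty _
      obtain ⟨⟨p, w, o⟩, hp⟩ := this
      exact ⟨_, NPDA.Step.read (PalState.scan_notMem_halt i k) hp⟩
  | accept hn => exact ⟨by omega, .inl (.inl rfl)⟩
  | reject hn => exact ⟨by omega, .inl (.inr rfl)⟩

theorem palNPDA_accepts_of_palRun {i : Fin 3} {u : List PalSym} : ∀ {k : Fin 6} {st s : List Bool},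
    palRun i k st u = some s → ∀ y, ∃ n γ,
      StepsIn palNPDA.Step ⟨PalState.scan i k, u.map Tape.sym ++ [Tape.right], palStack st, y⟩ n
        ⟨PalState.accept, [], γ, y ++ s⟩ := by
  induction u with
  | nil =>
    intro k st s h y
    obtain ⟨Z, v, hγ, hZ, -⟩ := palStack_cases st
    simp only [palRun] at h
    split_ifs at h with hk
    obtain rfl : [] = s := Option.some.inj h
    refine ⟨1, [Z] ++ v, StepsIn.refl.tail ?_⟩
    rw [hγ]
    refine NPDA.Step.read (o := none) (PalState.scan_notMem_halt i k) ?_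
    change (PalState.accept, [Z], none) ∈ palTrans (.scan i k) (some .right) Z
    simp only [palTrans]
    rw [if_pos]
    · rfl
    · simpa [hZ] using hk
  | cons a u ih =>
    intro k st s h y
    obtain ⟨Z, v, hγ, -⟩ := palStack_cases st
    rcases palMove_spec i k a u st hγ with ⟨-, h₁⟩ | ⟨k', w, o, st', h₁, h₂, h₃⟩
    · simp [h₁] at h
    · rw [h₃, Option.map_eq_some_iff] at h
      obtain ⟨s', hs', rfl⟩ := h
      obtain ⟨n, γ, hn⟩ := ih hs' (y ++ o.toList)
      refine ⟨n + 1, γ, StepsIn.head ?_ (by simpa using hn)⟩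
      rw [hγ, ← h₂]
      refine NPDA.Step.read (PalState.scan_notMem_halt i k) ?_
      change (PalState.scan i k', w, o) ∈ palTrans (.scan i k) (some (.sym a)) Z
      rw [palTrans_sym_some h₁]
      rfl

theorem mem_outputs_palNPDA {x : List PalSym} {y : List Bool} :
    y ∈ palNPDA.outputs x ↔ y = [] ∨ ∃ i, palRun i 0 [] x = some y := by
  constructor
  · rintro ⟨n, c, h, hc, rfl⟩
    cases palInv h with
    | init => cases hc
    | scan => cases hc
    | accept _ hy => exact hy
    | reject => cases hc
  · rintro (rfl | ⟨i, hi⟩)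
    · exact ⟨1, _, StepsIn.refl.tail (NPDA.Step.stay PalState.start_notMem_halt
        (p := PalState.accept) (w := [none]) (o := none) (Set.mem_singleton _)),
        Set.mem_singleton _, rfl⟩
    · obtain ⟨n, γ, hn⟩ := palNPDA_accepts_of_palRun hi []
      refine ⟨n + 1, _, StepsIn.head (NPDA.Step.read PalState.start_notMem_halt
        (p := PalState.scan i 0) (w := [none]) (o := none) ⟨i, rfl⟩) hn, Set.mem_singleton _, rfl⟩

/-! ### Reading the block decomposition off `palRun` -/

/-- The separator after block `k`. -/
def palSep (k : Fin 6) : PalSym := if k.1 = 2 then .hash else .nat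

theorem palSep_ne_bit (k : Fin 6) (b : Bool) : palSep k ≠ .bit b := by
  unfold palSep
  split_ifs <;> simp

/-- A leading bit joins the current block; with `exists_cons_eq_iff` for a leading separator, this
is the inductive step of the block lemmas below. -/
theorem exists_bit_cons_eq_iff {b : Bool} {u : List PalSym} {c : PalSym} (hc : ∀ b, c ≠ .bit b)
    {P : List Bool → List PalSym → Prop} :
    (∃ x r, .bit b :: u = bits x ++ c :: r ∧ P x r) ↔
      ∃ x r, u = bits x ++ c :: r ∧ P (b :: x) r := by
  constructor
  · rintro ⟨x, r, h, hP⟩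
    rcases x with _ | ⟨b', x⟩
    · exact absurd (List.cons.inj h).1.symm (hc b)
    · obtain ⟨h₁, h₂⟩ := List.cons.inj h
      cases h₁
      exact ⟨x, r, h₂, hP⟩
  · rintro ⟨x, r, rfl, hP⟩
    exact ⟨b :: x, r, rfl, hP⟩

theorem exists_cons_eq_iff {u : List PalSym} {a c : PalSym} (ha : ∀ b, a ≠ .bit b)
    {P : List Bool → List PalSym → Prop} :
    (∃ x r, a :: u = bits x ++ c :: r ∧ P x r) ↔ a = c ∧ P [] u := by
  constructor
  · rintro ⟨x, r, h, hP⟩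
    rcases x with _ | ⟨b', x⟩
    · obtain ⟨h₁, rfl⟩ := List.cons.inj h
      exact ⟨h₁, hP⟩
    · exact absurd (List.cons.inj h).1 (ha b')
  · rintro ⟨rfl, hP⟩
    exact ⟨[], u, rfl, hP⟩

theorem palRun_skip_iff {i : Fin 3} {k : Fin 6} (hk : k.1 ≠ 5) (h₁ : k.1 ≠ i.1)
    (h₂ : k.1 ≠ i.1 + 3) {u : List PalSym} {st s : List Bool} : palRun i k st u = some s ↔
      ∃ x r, u = bits x ++ palSep k :: r ∧ palRun i (k + 1) st r = some s := by
  induction u with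
  | nil => simp [palRun, hk]
  | cons a u ih =>
    cases a with
    | bit b =>
      rw [exists_bit_cons_eq_iff (palSep_ne_bit k), ← ih]
      simp [palRun, h₁, h₂]
    | nat =>
      rw [exists_cons_eq_iff (by simp)]
      by_cases hk2 : k.1 = 2 <;> simp [palRun, palSep, hk, h₂, hk2]
    | hash =>
      rw [exists_cons_eq_iff (by simp)]
      by_cases hk2 : k.1 = 2 <;> simp [palRun, palSep, hk2]

/-- The block to be compared is echoed on the output and ends up reversed on the stack. -/
theorem palRun_push_iff {i : Fin 3} {k : Fin 6} (h : k.1 = i.1) {u : List PalSym}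
    {st s : List Bool} : palRun i k st u = some s ↔
      ∃ x r, u = bits x ++ palSep k :: r ∧
        ∃ s', s = x ++ s' ∧ palRun i (k + 1) (x.reverse ++ st) r = some s' := by
  have hk : k.1 ≠ 5 := by omega
  have h₂ : i.1 ≠ 5 := by omega
  induction u generalizing st s with
  | nil => simp [palRun, hk]
  | cons a u ih =>
    cases a with
    | bit b =>
      rw [exists_bit_cons_eq_iff (palSep_ne_bit k)]
      simp only [palRun, h, if_true, Option.map_eq_some_iff, ih]
      constructor
      · rintro ⟨_, ⟨x, r, hu, s', rfl, hr⟩, rfl⟩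
        exact ⟨x, r, hu, s', by simp, by simpa using hr⟩
      · rintro ⟨x, r, hu, s', rfl, hr⟩
        exact ⟨_, ⟨x, r, hu, s', rfl, by simpa using hr⟩, by simp⟩
    | nat =>
      rw [exists_cons_eq_iff (by simp)]
      by_cases hk2 : k.1 = 2 <;> simp [palRun, palSep, ← h, hk2, hk]
    | hash =>
      rw [exists_cons_eq_iff (by simp)]
      by_cases hk2 : k.1 = 2 <;> simp [palRun, palSep, hk2]

/-- Each bit must equal the one popped, and the separator is passed only with an empty stack, so the
block equals the stack read from the top. -/
theorem palRun_pop_iff {i : Fin 3} {k : Fin 6} (hk : k.1 ≠ 5) (h : k.1 = i.1 + 3)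
    {u : List PalSym} {st s : List Bool} : palRun i k st u = some s ↔
      ∃ x r, u = bits x ++ palSep k :: r ∧
        ∃ s', s = x ++ s' ∧ x = st ∧ palRun i (k + 1) [] r = some s' := by
  have hk2 : k.1 ≠ 2 := by omega
  have h₁ : k.1 ≠ i.1 := by omega
  induction u generalizing st s with
  | nil => simp [palRun, hk]
  | cons a u ih =>
    cases a with
    | bit b =>
      rw [exists_bit_cons_eq_iff (palSep_ne_bit k)]
      simp only [palRun, h₁, if_false, if_pos h]
      rcases st with _ | ⟨c, st⟩
      · simp
      · by_cases hc : c = b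
        · subst hc
          simp only [List.head?_cons, if_true, List.tail_cons, Option.map_eq_some_iff, ih,
            List.cons.injEq, true_and]
          constructor
          · rintro ⟨_, ⟨x, r, hu, s', rfl, hr⟩, rfl⟩
            exact ⟨x, r, hu, s', by simp, hr⟩
          · rintro ⟨x, r, hu, s', rfl, hr⟩
            exact ⟨_, ⟨x, r, hu, s', rfl, hr⟩, by simp⟩
        · simp [hc, Ne.symm hc]
    | nat =>
      rw [exists_cons_eq_iff (by simp)]
      rcases st with _ | ⟨c, st⟩ <;> simp [palRun, palSep, hk, hk2, ← h]
    | hash =>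
      rw [exists_cons_eq_iff (by simp)]
      simp [palRun, palSep, hk2]

theorem cons_ne_bits {a : PalSym} (ha : ∀ b, a ≠ .bit b) (u : List PalSym) (x : List Bool) :
    a :: u ≠ bits x := by
  rcases x with _ | ⟨b, x⟩
  · exact List.cons_ne_nil _ _
  · exact fun h => ha b (List.cons.inj h).1

/-- The last block is ended by the input and not by a separator, which is why it is treated apart.
-/
theorem palRun_last_skip_iff {i : Fin 3} (hi : i.1 ≠ 2) {u : List PalSym} {st s : List Bool} :
    palRun i 5 st u = some s ↔ (∃ x, u = bits x) ∧ s = [] := by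
  have h₁ : 5 ≠ i.1 := by omega
  have h₂ : 5 ≠ i.1 + 3 := by omega
  induction u with
  | nil => simp [palRun, h₂, bits, eq_comm]
  | cons a u ih =>
    cases a with
    | bit b =>
      simp only [palRun, Fin.coe_ofNat_eq_mod, Nat.reduceMod, h₁, if_false, h₂, ih]
      refine and_congr_left fun _ => ⟨?_, ?_⟩
      · rintro ⟨x, rfl⟩
        exact ⟨b :: x, rfl⟩
      · rintro ⟨_ | ⟨c, x⟩, h⟩
        · cases h
        · exact ⟨x, (List.cons.inj h).2⟩
    | nat =>
      simp only [palRun, Fin.coe_ofNat_eq_mod, Nat.reduceMod]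
      simp [cons_ne_bits]
    | hash =>
      simp only [palRun, Fin.coe_ofNat_eq_mod, Nat.reduceMod]
      simp [cons_ne_bits]

theorem palRun_last_pop_iff {u : List PalSym} {st s : List Bool} :
    palRun 2 5 st u = some s ↔ u = bits st ∧ s = st := by
  induction u generalizing st s with
  | nil =>
    rcases st with _ | ⟨c, st⟩
    · simp [palRun, bits, eq_comm]
    · simp [palRun, bits]
  | cons a u ih =>
    cases a with
    | bit b =>
      rcases st with _ | ⟨c, st⟩
      · simp [palRun, bits]
      · by_cases hc : c = b
        · subst hc
          simp [palRun, ih, bits, eq_comm]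
        · simp [palRun, bits, hc, Ne.symm hc]
    | nat => simp [palRun, cons_ne_bits]
    | hash => simp [palRun, cons_ne_bits]

theorem palNPDA_outputs (x : List PalSym) : palNPDA.outputs x = palPairs x := by
  ext y
  rw [mem_outputs_palNPDA]
  refine or_congr Iff.rfl ?_
  constructor
  · rintro ⟨i, h⟩
    obtain rfl | rfl | rfl : i = 0 ∨ i = 1 ∨ i = 2 := by omega
    · obtain ⟨x₀, r, rfl, s₁, rfl, h₁⟩ := (palRun_push_iff rfl).1 h
      obtain ⟨x₁, r, rfl, h₂⟩ := (palRun_skip_iff (by decide) (by decide) (by decide)).1 h₁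
      obtain ⟨x₂, r, rfl, h₃⟩ := (palRun_skip_iff (by decide) (by decide) (by decide)).1 h₂
      obtain ⟨x₃, r, rfl, s₄, rfl, hx, h₄⟩ := (palRun_pop_iff (by decide) rfl).1 h₃
      obtain ⟨x₄, r, rfl, h₅⟩ := (palRun_skip_iff (by decide) (by decide) (by decide)).1 h₄
      obtain ⟨⟨x₅, rfl⟩, rfl⟩ := (palRun_last_skip_iff (by decide)).1 h₅
      exact ⟨![x₀, x₁, x₂], ![x₃, x₄, x₅], by simp [palSep], 0, by simp [hx], by simp⟩
    · obtain ⟨x₀, r, rfl, h₁⟩ := (palRun_skip_iff (by decide) (by decide) (by decide)).1 h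
      obtain ⟨x₁, r, rfl, s₂, rfl, h₂⟩ := (palRun_push_iff rfl).1 h₁
      obtain ⟨x₂, r, rfl, h₃⟩ := (palRun_skip_iff (by decide) (by decide) (by decide)).1 h₂
      obtain ⟨x₃, r, rfl, h₄⟩ := (palRun_skip_iff (by decide) (by decide) (by decide)).1 h₃
      obtain ⟨x₄, r, rfl, s₅, rfl, hx, h₅⟩ := (palRun_pop_iff (by decide) rfl).1 h₄
      obtain ⟨⟨x₅, rfl⟩, rfl⟩ := (palRun_last_skip_iff (by decide)).1 h₅
      exact ⟨![x₀, x₁, x₂], ![x₃, x₄, x₅], by simp [palSep], 1, by simp [hx], by simp⟩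
    · obtain ⟨x₀, r, rfl, h₁⟩ := (palRun_skip_iff (by decide) (by decide) (by decide)).1 h
      obtain ⟨x₁, r, rfl, h₂⟩ := (palRun_skip_iff (by decide) (by decide) (by decide)).1 h₁
      obtain ⟨x₂, r, rfl, s₃, rfl, h₃⟩ := (palRun_push_iff rfl).1 h₂
      obtain ⟨x₃, r, rfl, h₄⟩ := (palRun_skip_iff (by decide) (by decide) (by decide)).1 h₃
      obtain ⟨x₄, r, rfl, h₅⟩ := (palRun_skip_iff (by decide) (by decide) (by decide)).1 h₄
      obtain ⟨rfl, rfl⟩ := palRun_last_pop_iff.1 h₅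
      exact ⟨![x₀, x₁, x₂], ![x₃, x₄, x₂.reverse], by simp [palSep], 2, by simp, by simp⟩
  · rintro ⟨a, b, rfl, i, hi, rfl⟩
    refine ⟨i, ?_⟩
    obtain rfl | rfl | rfl : i = 0 ∨ i = 1 ∨ i = 2 := by omega
    · refine (palRun_push_iff rfl).2 ⟨a 0, _, by simp [palSep]; rfl, _, rfl, ?_⟩
      refine (palRun_skip_iff (by decide) (by decide) (by decide)).2
        ⟨a 1, _, by simp [palSep]; rfl, ?_⟩
      refine (palRun_skip_iff (by decide) (by decide) (by decide)).2
        ⟨a 2, _, by simp [palSep]; rfl, ?_⟩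
      refine (palRun_pop_iff (by decide) rfl).2
        ⟨b 0, _, by simp [palSep]; rfl, [], by simp, by simp_all, ?_⟩
      refine (palRun_skip_iff (by decide) (by decide) (by decide)).2
        ⟨b 1, _, by simp [palSep]; rfl, ?_⟩
      exact (palRun_last_skip_iff (by decide)).2 ⟨⟨b 2, rfl⟩, rfl⟩
    · refine (palRun_skip_iff (by decide) (by decide) (by decide)).2
        ⟨a 0, _, by simp [palSep]; rfl, ?_⟩
      refine (palRun_push_iff rfl).2 ⟨a 1, _, by simp [palSep]; rfl, _, rfl, ?_⟩
      refine (palRun_skip_iff (by decide) (by decide) (by decide)).2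
        ⟨a 2, _, by simp [palSep]; rfl, ?_⟩
      refine (palRun_skip_iff (by decide) (by decide) (by decide)).2
        ⟨b 0, _, by simp [palSep]; rfl, ?_⟩
      refine (palRun_pop_iff (by decide) rfl).2
        ⟨b 1, _, by simp [palSep]; rfl, [], by simp, by simp_all, ?_⟩
      exact (palRun_last_skip_iff (by decide)).2 ⟨⟨b 2, rfl⟩, rfl⟩
    · refine (palRun_skip_iff (by decide) (by decide) (by decide)).2
        ⟨a 0, _, by simp [palSep]; rfl, ?_⟩
      refine (palRun_skip_iff (by decide) (by decide) (by decide)).2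
        ⟨a 1, _, by simp [palSep]; rfl, ?_⟩
      refine (palRun_push_iff rfl).2 ⟨a 2, _, by simp [palSep]; rfl, _, rfl, ?_⟩
      refine (palRun_skip_iff (by decide) (by decide) (by decide)).2
        ⟨b 0, _, by simp [palSep]; rfl, ?_⟩
      refine (palRun_skip_iff (by decide) (by decide) (by decide)).2
        ⟨b 1, _, by simp [palSep]; rfl, ?_⟩
      exact palRun_last_pop_iff.2 ⟨by simp_all, by simp_all⟩

/-- Every pair consists of two blocks of `w`, so its length is bounded by that of `w`. Finiteness
guarantees a maximum, which the dictionary order alone does not. -/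
theorem palPairs_finite (w : List PalSym) : (palPairs w).Finite := by
  refine (List.finite_length_le Bool w.length).subset ?_
  rintro s (rfl | ⟨x, y, rfl, i, -, rfl⟩)
  · simp
  · fin_cases i <;> simp [bits] <;> omega

theorem exists_isDictMax_palPairs (w : List PalSym) :
    ∃ y, IsDictMax inferInstance (palPairs w) y := by
  obtain ⟨y, hy, hmax⟩ := Set.exists_max_image (palPairs w) id (palPairs_finite w)
    ⟨[], .inl rfl⟩
  refine ⟨y, hy, fun z hz => ?_⟩
  rcases (hmax z hz).eq_or_lt with h | h
  · exact .inl h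
  · exact .inr h

theorem IsDictMax.unique {G : Type} {ord : LinearOrder G} {Y : Set (List G)} {y z : List G}
    (hy : IsDictMax ord Y y) (hz : IsDictMax ord Y z) : z = y := by
  rcases hy.2 z hz.1 with h | h
  · exact h
  rcases hz.2 y hy.1 with h' | h'
  · exact h'.symm
  · exact absurd h' (asymm (r := List.Lex ord.lt) h)

theorem maxPalPair_mem_OptCFL : maxPalPair ∈ OptCFL := by
  refine ⟨palNPDA, palNPDA_terminates, .inl fun x => ?_⟩
  obtain ⟨y, hy⟩ := exists_isDictMax_palPairs x
  refine ⟨y, ?_, ?_⟩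
  · ext z
    exact ⟨fun hz => hy.unique hz, fun hz => by rw [Set.mem_singleton_iff.1 hz]; exact hy⟩
  · exact (palNPDA_outputs x).symm ▸ hy

end CFLFun

namespace CFLFun

/-! ### Steps of oracle npda's -/

namespace OracleNPDA

variable {S D G : Type} {M : OracleNPDA S D G} {A : Language D}

theorem Step.of_trans {q p : M.Q} {a : Option (Tape S)} {u : List (Tape S)}
    {Z : M.Stk} {v w : List M.Stk} {d : Option D} {o : Option G} {s : List D} {y : List G}
    (hq : q ∉ M.halt) (hq' : q ≠ M.query) (ht : (p, w, d, o) ∈ M.trans q a Z) :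
    M.Step A ⟨q, a.toList ++ u, Z :: v, s, y⟩
      ⟨p, u, w ++ v, s ++ d.toList, y ++ o.toList⟩ := by
  rcases a with _ | a
  · exact .stay hq hq' ht
  · exact .read hq hq' ht

theorem Step.inv {q : M.Q} {u : List (Tape S)} {γ : List M.Stk} {s : List D} {y : List G}
    {c : M.Config} (h : M.Step A ⟨q, u, γ, s, y⟩ c) :
    (q ∉ M.halt ∧ q ≠ M.query ∧ ∃ a u' Z v p w d o, u = a.toList ++ u' ∧ γ = Z :: v ∧
      (p, w, d, o) ∈ M.trans q a Z ∧ c = ⟨p, u', w ++ v, s ++ d.toList, y ++ o.toList⟩) ∨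
    (q = M.query ∧ (s ∈ A ∧ c = ⟨M.yes, u, γ, [], y⟩ ∨ s ∉ A ∧ c = ⟨M.no, u, γ, [], y⟩)) := by
  cases h with
  | stay hq hq' ht => exact .inl ⟨hq, hq', none, _, _, _, _, _, _, _, rfl, rfl, ht, rfl⟩
  | read hq hq' ht => exact .inl ⟨hq, hq', some _, _, _, _, _, _, _, _, rfl, rfl, ht, rfl⟩
  | ask_yes hs => exact .inr ⟨rfl, .inl ⟨hs, rfl⟩⟩
  | ask_no hs => exact .inr ⟨rfl, .inr ⟨hs, rfl⟩⟩

end OracleNPDA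

/-! ### Tapes -/

/-- The input symbols on a piece of the tape. -/
def symsOf {S : Type} (u : List (Tape S)) : List S :=
  u.filterMap fun a => match a with
    | .sym s => some s
    | _ => none

/-- Whether a tape symbol is the right endmarker. -/
def Tape.isRight {S : Type} : Tape S → Bool
  | .right => true
  | _ => false

/-- A partial map of symbols, extended to the endmarkers. -/
def projTape {T S : Type} (f : T → Option S) : Tape T → Option (Tape S)
  | .left => some .left
  | .sym t => (f t).map .sym
  | .right => some .right

theorem symsOf_append {S : Type} (u v : List (Tape S)) : symsOf (u ++ v) = symsOf u ++ symsOf v :=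
  List.filterMap_append

theorem symsOf_tapeOf {S : Type} (x : List S) : symsOf (tapeOf x) = x := by
  have : symsOf (x.map Tape.sym) = x := by
    induction x with
    | nil => rfl
    | cons a x ih =>
      rw [symsOf] at ih
      simp [symsOf, ih]
  rw [tapeOf, ← List.cons_append, symsOf_append, ← List.singleton_append, symsOf_append, this]
  simp [symsOf]

theorem filterMap_projTape_tapeOf {T S : Type} (f : T → Option S) (t : List T) :
    (tapeOf t).filterMap (projTape f) = tapeOf (t.filterMap f) := by
  have : (t.map Tape.sym).filterMap (projTape f) = (t.filterMap f).map Tape.sym := by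
    rw [List.filterMap_map, List.map_filterMap]
    rfl
  simp [tapeOf, List.filterMap_append, this, projTape]

theorem isRight_iff_of_tapeOf_eq {S : Type} {x : List S} {u v : List (Tape S)} {a : Tape S}
    (h : tapeOf x = u ++ a :: v) : a.isRight = true ↔ v = [] := by
  have h0 : tapeOf x = (Tape.left :: x.map Tape.sym) ++ [Tape.right] := rfl
  rcases List.eq_nil_or_concat v with rfl | ⟨v, b, rfl⟩
  · have := List.append_inj' (h0.symm.trans h) rfl
    simp only [List.cons.injEq, and_true] at this
    simp [← this.2, Tape.isRight]
  · have h' : (Tape.left :: x.map Tape.sym) ++ [Tape.right] = (u ++ a :: v) ++ [b] := by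
      rw [← h0, h]
      simp
    have := (List.append_inj' h' rfl).1
    have ha : a ∈ Tape.left :: x.map Tape.sym := by simp [this]
    cases a <;> simp [Tape.isRight] at ha ⊢

/-! ### Simulation of an npda by an oracle npda -/

/-- A finite control accompanying the simulation of an npda with input alphabet `S` and output
alphabet `H` by an oracle npda with input alphabet `T`: each input symbol is translated into a
symbol of `S` or ignored, and the control reacts to the input symbols and to the output symbols of
the simulated machine by writing on the query tape and on the output tape. -/
structure Controller (S H T D G : Type) where
  C : Type
  finC : Finite C
  start : C
  proj : T → Option S
  onRead : C → T → Set (C × Option D)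
  onWrite : C → H → Set (C × Option D × Option G)
  onRead_nonempty : ∀ c t, (onRead c t).Nonempty
  onWrite_nonempty : ∀ c h, (onWrite c h).Nonempty
  final : Set C

namespace Controller

variable {S H T D G : Type} (K : Controller S H T D G)

def read (c : K.C) : Tape T → Set (K.C × Option D)
  | .sym t => K.onRead c t
  | _ => {(c, none)}

def write (c : K.C) : Option H → Set (K.C × Option D × Option G)
  | some h => K.onWrite c h
  | none => {(c, none, none)}

theorem read_nonempty (c : K.C) (t : Tape T) : (K.read c t).Nonempty := by
  cases t
  · exact Set.singleton_nonempty _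
  · exact K.onRead_nonempty _ _
  · exact Set.singleton_nonempty _

theorem write_nonempty (c : K.C) (h : Option H) : (K.write c h).Nonempty := by
  cases h
  · exact Set.singleton_nonempty _
  · exact K.onWrite_nonempty _ _

variable {K}

/-- `I` is preserved by all reactions of the control. -/
structure Preserved (K : Controller S H T D G)
    (I : List T → List H → K.C → List D → List G → Prop) : Prop where
  init : I [] [] K.start [] []
  onRead : ∀ {u z c s g t c' d}, I u z c s g → (c', d) ∈ K.onRead c t →
    I (u ++ [t]) z c' (s ++ d.toList) g
  onWrite : ∀ {u z c s g h c' d o}, I u z c s g → (c', d, o) ∈ K.onWrite c h →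
    I u (z ++ [h]) c' (s ++ d.toList) (g ++ o.toList)

theorem Preserved.read {I : List T → List H → K.C → List D → List G → Prop}
    (hI : Preserved K I) {u : List (Tape T)} {z : List H} {c c' : K.C}
    {s : List D} {g : List G} {a : Tape T} {d : Option D} (h : I (symsOf u) z c s g)
    (hc : (c', d) ∈ K.read c a) : I (symsOf (u ++ [a])) z c' (s ++ d.toList) g := by
  rw [symsOf_append]
  cases a with
  | sym a => exact hI.onRead h hc
  | _ =>
    cases Set.mem_singleton_iff.1 hc
    simpa [symsOf] using h

theorem Preserved.write {I : List T → List H → K.C → List D → List G → Prop}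
    (hI : Preserved K I) {u : List T} {z : List H} {c c' : K.C}
    {s : List D} {g : List G} {o : Option H} {d : Option D} {e : Option G} (h : I u z c s g)
    (hc : (c', d, e) ∈ K.write c o) :
    I u (z ++ o.toList) c' (s ++ d.toList) (g ++ e.toList) := by
  cases o with
  | some o => exact hI.onWrite h hc
  | none =>
    cases Set.mem_singleton_iff.1 hc
    simpa using h

/-- The control can react so that `J` is preserved. -/
structure Preservable (K : Controller S H T D G)
    (J : List T → List H → K.C → List D → List G → Prop) : Prop where
  init : J [] [] K.start [] []
  onRead : ∀ {u z c s g} (t), J u z c s g →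
    ∃ c' d, (c', d) ∈ K.onRead c t ∧ J (u ++ [t]) z c' (s ++ d.toList) g
  onWrite : ∀ {u z c s g} (h), J u z c s g → ∃ c' d o, (c', d, o) ∈ K.onWrite c h ∧
    J u (z ++ [h]) c' (s ++ d.toList) (g ++ o.toList)

theorem Preservable.read {J : List T → List H → K.C → List D → List G → Prop}
    (hJ : Preservable K J) {u : List (Tape T)} {z : List H} {c : K.C}
    {s : List D} {g : List G} (a : Tape T) (h : J (symsOf u) z c s g) :
    ∃ c' d, (c', d) ∈ K.read c a ∧ J (symsOf (u ++ [a])) z c' (s ++ d.toList) g := by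
  rw [symsOf_append]
  cases a with
  | sym a => exact hJ.onRead a h
  | _ => exact ⟨c, none, rfl, by simpa [symsOf] using h⟩

theorem Preservable.write {J : List T → List H → K.C → List D → List G → Prop}
    (hJ : Preservable K J) {u : List T} {z : List H} {c : K.C}
    {s : List D} {g : List G} (o : Option H) (h : J u z c s g) :
    ∃ c' d e, (c', d, e) ∈ K.write c o ∧
      J u (z ++ o.toList) c' (s ++ d.toList) (g ++ e.toList) := by
  cases o with
  | some o => exact hJ.onWrite o h
  | none => exact ⟨c, none, none, rfl, by simpa using h⟩

variable (K)

theorem _root_.CFLFun.NPDA.notMem_rej {M : NPDA S H} {q : M.Q} (hq : q ∈ M.acc) : q ∉ M.rej :=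
  fun h => Set.disjoint_left.1 M.disj hq h

/-- States of the simulating machine; `go q buf eof c` holds the state `q` of the simulated machine,
a tape symbol that it has not read yet, whether the input is exhausted, and the control. -/
inductive State (Q S C : Type) : Type
  | start : State Q S C
  | go (q : Q) (buf : Option (Tape S)) (eof : Bool) (c : C) : State Q S C
  | query : State Q S C
  | yes : State Q S C
  | no : State Q S C
  | fail : State Q S C

instance State.finite {Q S C : Type} [Finite Q] [Finite S] [Finite C] :
    Finite (State Q S C) := by
  refine Finite.of_injective (fun s : State Q S C => match s with
      | .start => (.inl 0 : Fin 5 ⊕ (Q × Option (Tape S) × Bool × C))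
      | .query => .inl 1
      | .yes => .inl 2
      | .no => .inl 3
      | .fail => .inl 4
      | .go q b e c => .inr (q, b, e, c)) ?_
  intro s t h
  cases s <;> cases t <;> simp_all

variable (M : NPDA S H)

/-- Moves of the simulating machine, whose stack has an extra bottom symbol `none`. -/
inductive Move : State M.Q S K.C → Option (Tape T) → Option M.Stk →
    State M.Q S K.C × List (Option M.Stk) × Option D × Option G → Prop
  -- The simulated machine may empty its stack, but a move needs a top symbol; the extra bottom
  -- symbol lets the fetches and the query go on.
  | start (Z : Option M.Stk) : Move .start none Z
      (.go M.start none false K.start, [some M.bottom, none], none, none)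
  | stay {q p : M.Q} {buf : Option (Tape S)} {eof : Bool} {c c' : K.C} {Z : M.Stk}
      {w : List M.Stk} {o : Option H} {d : Option D} {g : Option G} : q ∉ M.halt →
      (p, w, o) ∈ M.trans q none Z → (c', d, g) ∈ K.write c o →
      Move (.go q buf eof c) none (some Z) (.go p buf eof c', w.map some, d, g)
  -- Fetching a symbol and using it are separate moves because the control may write a query symbol
  -- at each, and one step writes at most one.
  | use {q p : M.Q} {a : Tape S} {eof : Bool} {c c' : K.C} {Z : M.Stk}
      {w : List M.Stk} {o : Option H} {d : Option D} {g : Option G} : q ∉ M.halt →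
      (p, w, o) ∈ M.trans q (some a) Z → (c', d, g) ∈ K.write c o →
      Move (.go q (some a) eof c) none (some Z) (.go p none eof c', w.map some, d, g)
  -- After acceptance the remaining input is still fetched, so that the control sees all of it; the
  -- buffer content is then discarded.
  | fetch {q : M.Q} {buf : Option (Tape S)} {c c' : K.C} {t : Tape T} {Z : Option M.Stk}
      {d : Option D} : q ∈ M.acc ∨ q ∉ M.halt ∧ buf = none → (c', d) ∈ K.read c t →
      Move (.go q buf false c) (some t) Z (.go q (projTape K.proj t) t.isRight c', [Z], d, none)
  | ask {q : M.Q} {buf : Option (Tape S)} {c : K.C} {Z : Option M.Stk} : q ∈ M.acc →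
      c ∈ K.final → Move (.go q buf true c) none Z (.query, [Z], none, none)
  | fail {q : M.Q} {buf : Option (Tape S)} {c : K.C} {Z : Option M.Stk} : q ∈ M.acc →
      c ∉ K.final → Move (.go q buf true c) none Z (.fail, [Z], none, none)

/-- The machine that simulates `M` under the control `K`, asks one query when the simulated machine
has accepted and all of the input is read, and accepts if the answer is `yes`. -/
abbrev sim [Finite S] [Finite D] [Finite G] : OracleNPDA T D G where
  Q := State M.Q S K.C
  Stk := Option M.Stk
  finQ := by
    have := M.finQ
    have := K.finC
    infer_instance
  finStk := by
    have := M.finStk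
    infer_instance
  start := .start
  bottom := none
  acc := {.yes}
  rej := {s | s = .no ∨ s = .fail ∨ ∃ q buf eof c, s = .go q buf eof c ∧ q ∈ M.rej}
  disj := by
    rw [Set.disjoint_singleton_left]
    simp
  query := .query
  yes := .yes
  no := .no
  query_ne_yes := by simp
  query_ne_no := by simp
  yes_ne_no := by simp
  query_notMem := by simp
  trans q a Z := {r | K.Move M q a Z r}
  finTrans q a Z := by
    have := M.finQ
    have := M.finStk
    have := K.finC
    obtain ⟨L, hL⟩ := M.exists_push_bound
    refine ((Set.finite_univ (α := State M.Q S K.C)).prod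
      ((List.finite_length_le (Option M.Stk) (L + 2)).prod
        (Set.finite_univ (α := Option D × Option G)))).subset ?_
    rintro ⟨p, w, d, g⟩ h
    refine ⟨trivial, ?_, trivial⟩
    change w.length ≤ L + 2
    cases h with
    | stay _ h _ =>
      have := hL _ _ _ _ h
      simp only [List.length_map] at this ⊢
      omega
    | use _ h _ =>
      have := hL _ _ _ _ h
      simp only [List.length_map] at this ⊢
      omega
    | _ => simp

variable {K M} [Finite S] [Finite D] [Finite G]

theorem go_notMem_halt {q : M.Q} (hq : q ∉ M.rej) (buf : Option (Tape S)) (eof : Bool) (c : K.C) :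
    (.go q buf eof c : (K.sim M).Q) ∉ (K.sim M).halt := by
  rintro (h | h | h | ⟨_, _, _, _, h, h'⟩)
  · cases h
  · cases h
  · cases h
  · cases h
    exact hq h'

theorem sim_step {A : Language D} {q p : State M.Q S K.C} {a : Option (Tape T)}
    {u : List (Tape T)} {Z : Option M.Stk} {v w : List (Option M.Stk)} {d : Option D}
    {o : Option G} {s : List D} {y : List G} (h : K.Move M q a Z (p, w, d, o))
    (hq : q ∉ (K.sim M).halt) :
    (K.sim M).Step A ⟨q, a.toList ++ u, Z :: v, s, y⟩
      ⟨p, u, w ++ v, s ++ d.toList, y ++ o.toList⟩ := by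
  refine OracleNPDA.Step.of_trans hq ?_ h
  rintro rfl
  cases h

/-- What is known after `n` steps on input `t`, where `N` bounds the number of steps of the
simulated machine, and `I` is an invariant relating the input read, the output of the simulated machine, the
control, the query tape and the output tape. -/
inductive Inv (K : Controller S H T D G) (M : NPDA S H) [Finite S] [Finite D] [Finite G]
    (I : List T → List H → K.C → List D → List G → Prop)
    (A : Language D) (t : List T) (N : ℕ) : ℕ → (K.sim M).Config → Prop
  | init : Inv K M I A t N 0 ((K.sim M).init t)
  | go {m n : ℕ} {q : M.Q} {u : List (Tape S)} {γ : List M.Stk} {z : List H}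
      {buf : Option (Tape S)} {eof : Bool} {c : K.C} {used rest : List (Tape T)}
      {s : List D} {g : List G} :
      StepsIn M.Step (M.init (t.filterMap K.proj)) m ⟨q, u, γ, z⟩ → tapeOf t = used ++ rest →
      (eof = true ↔ rest = []) →
      -- Once the simulated machine has accepted, later fetches overwrite the buffer and the two
      -- inputs no longer correspond.
      (q ∉ M.acc → u = buf.toList ++ rest.filterMap (projTape K.proj)) →
      -- One starting move; every other move is a simulated step or a fetch.
      n ≤ 1 + m + used.length → I (symsOf used) z c s g →
      Inv K M I A t N n ⟨.go q buf eof c, rest, γ.map some ++ [none], s, g⟩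
  | query {n : ℕ} {z : List H} {c : K.C} {v : List (Option M.Stk)} {s : List D} {g : List G} :
      z ∈ M.outputs (t.filterMap K.proj) → I t z c s g → c ∈ K.final → n ≤ N + t.length + 4 →
      Inv K M I A t N n ⟨.query, [], v, s, g⟩
  | yes {n : ℕ} {z : List H} {c : K.C} {v : List (Option M.Stk)} {s : List D} {g : List G} :
      z ∈ M.outputs (t.filterMap K.proj) → I t z c s g → c ∈ K.final → s ∈ A →
      n ≤ N + t.length + 5 → Inv K M I A t N n ⟨.yes, [], v, [], g⟩
  | no {n : ℕ} {u : List (Tape T)} {v : List (Option M.Stk)} {s : List D} {g : List G} :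
      n ≤ N + t.length + 5 → Inv K M I A t N n ⟨.no, u, v, s, g⟩
  | fail {n : ℕ} {u : List (Tape T)} {v : List (Option M.Stk)} {s : List D} {g : List G} :
      n ≤ N + t.length + 5 → Inv K M I A t N n ⟨.fail, u, v, s, g⟩

/-! ### Termination, soundness and completeness of the simulation -/

variable {I : List T → List H → K.C → List D → List G → Prop} {A : Language D} {t : List T}
  {N n : ℕ}

theorem Inv.step (hI : Preserved K I)
    (hN : ∀ m c, StepsIn M.Step (M.init (t.filterMap K.proj)) m c → m ≤ N)
    {c c' : (K.sim M).Config} (h : Inv K M I A t N n c) (hs : (K.sim M).Step A c c') :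
    Inv K M I A t N (n + 1) c' := by
  cases h with
  | init =>
    obtain ⟨-, -, a, u', Z, v, p, w, d, o, hu, hγ, ht, rfl⟩ | ⟨h, -⟩ := hs.inv
    · obtain ⟨rfl, rfl⟩ := List.cons.inj hγ
      cases ht with
      | start =>
        obtain rfl : tapeOf t = u' := hu
        exact .go (γ := [M.bottom]) (z := []) (used := []) .refl rfl (by simp [tapeOf])
          (fun _ => (filterMap_projTape_tapeOf _ _).symm) (by omega) hI.init
    · cases h
  | @go m n q u γ z buf eof c used rest s g hm ht he hu hn hi =>
    obtain ⟨-, -, a, u', Z, v, p, w, d, o, hr, hγ, htr, rfl⟩ | ⟨h, -⟩ := hs.inv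
    swap
    · cases h
    have hlen := congrArg List.length ht
    simp only [tapeOf, List.length_cons, List.length_append, List.length_map,
      List.length_nil] at hlen
    have hmN := hN _ _ hm
    cases htr with
    | @stay _ p _ _ _ c' Z w o' d g' hq htr hc =>
      rcases γ with _ | ⟨Y, γ⟩
      · cases hγ
      obtain ⟨hY, rfl⟩ := List.cons.inj hγ
      cases hY
      obtain rfl : rest = u' := hr
      have hγ' : w.map some ++ (γ.map some ++ [none]) = (w ++ γ).map some ++ [none] := by simp
      change Inv K M I A t N _ ⟨_, _, w.map some ++ (γ.map some ++ [none]), _, _⟩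
      rw [hγ']
      exact .go (hm.tail (.stay hq htr)) ht he (fun _ => hu fun h => hq (.inl h)) (by omega)
        (hI.write hi hc)
    | @use _ p a _ _ c' Z w o' d g' hq htr hc =>
      rcases γ with _ | ⟨Y, γ⟩
      · cases hγ
      obtain ⟨hY, rfl⟩ := List.cons.inj hγ
      cases hY
      obtain rfl : rest = u' := hr
      obtain rfl := hu fun h => hq (.inl h)
      have hγ' : w.map some ++ (γ.map some ++ [none]) = (w ++ γ).map some ++ [none] := by simp
      change Inv K M I A t N _ ⟨_, _, w.map some ++ (γ.map some ++ [none]), _, _⟩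
      rw [hγ']
      exact .go (hm.tail (.read hq htr)) ht he (fun _ => rfl) (by omega)
        (hI.write hi hc)
    | @fetch _ _ _ c' a _ d hq hc =>
      subst hr
      rw [List.singleton_append, ← hγ, Option.toList_none, List.append_nil]
      refine .go (used := used ++ [a]) hm (by simpa using ht)
        (isRight_iff_of_tapeOf_eq (by simpa using ht)) (fun h => ?_) ?_ (hI.read hi hc)
      · obtain ⟨-, rfl⟩ := hq.resolve_left h
        rw [hu h]
        simp [List.filterMap_cons]
        cases projTape K.proj a <;> rfl
      · simp
        omega
    | ask hq hc =>
      obtain rfl : rest = u' := hr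
      obtain rfl : rest = [] := he.1 rfl
      obtain rfl : tapeOf t = used := by simpa using ht
      rw [symsOf_tapeOf] at hi
      simp only [Option.toList_none, List.append_nil] at hlen ⊢
      exact .query ⟨_, _, hm, hq, rfl⟩ hi hc (by omega)
    | fail hq hc =>
      exact .fail (by omega)
  | @query n z c v s g hz hi hc hn =>
    obtain ⟨-, h, -⟩ | ⟨-, ⟨hA, rfl⟩ | ⟨-, rfl⟩⟩ := hs.inv
    · exact absurd rfl h
    · exact .yes hz hi hc hA (by omega)
    · exact .no (by omega)
  | yes =>
    obtain ⟨h, -⟩ | ⟨h, -⟩ := hs.inv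
    · exact absurd (.inl rfl) h
    · cases h
  | no =>
    obtain ⟨h, -⟩ | ⟨h, -⟩ := hs.inv
    · exact absurd (.inr (.inl rfl)) h
    · cases h
  | fail =>
    obtain ⟨h, -⟩ | ⟨h, -⟩ := hs.inv
    · exact absurd (.inr (.inr (.inl rfl))) h
    · cases h

theorem inv_of_stepsIn (hI : Preserved K I)
    (hN : ∀ m c, StepsIn M.Step (M.init (t.filterMap K.proj)) m c → m ≤ N)
    {c : (K.sim M).Config} (h : StepsIn ((K.sim M).Step A) ((K.sim M).init t) n c) :
    Inv K M I A t N n c := by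
  induction h with
  | refl => exact .init
  | tail _ hs ih => exact ih.step hI hN hs

/-- The time is that of the simulated machine plus one fetch per tape symbol and a constant. No
configuration gets stuck: a simulated machine that has not halted has a next move, and if that move
reads, its symbol is in the buffer or can still be fetched. -/
theorem sim_terminates (hM : M.Terminates) : (K.sim M).Terminates := by
  obtain ⟨a, b, hab⟩ := hM
  refine ⟨a + 1, b + 5, fun A t n c h => ?_⟩
  have hlt : (t.filterMap K.proj).length ≤ t.length := List.length_filterMap_le _ _
  have hN : ∀ m c, StepsIn M.Step (M.init (t.filterMap K.proj)) m c → m ≤ a * t.length + b :=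
    fun m c h => ((hab _ _ _ h).1).trans (by gcongr)
  have hexp : (a + 1) * t.length = a * t.length + t.length := by ring
  -- Termination does not depend on what the control writes, so the trivial invariant is enough.
  have hinv := inv_of_stepsIn (I := fun _ _ _ _ _ => True)
    ⟨trivial, fun _ _ => trivial, fun _ _ => trivial⟩ hN h
  cases hinv with
  | init =>
    exact ⟨by omega, .inr ⟨_, sim_step (a := none) (.start none) (by simp [OracleNPDA.halt])⟩⟩
  | @go m n q u γ z buf eof c used rest s g hm ht he hu hn hi =>
    have hlen := congrArg List.length ht
    simp only [tapeOf, List.length_cons, List.length_append, List.length_map,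
      List.length_nil] at hlen
    have hmN := hN _ _ hm
    refine ⟨by omega, ?_⟩
    by_cases hrej : q ∈ M.rej
    · exact .inl (.inr (.inr (.inr ⟨_, _, _, _, rfl, hrej⟩)))
    right
    have hgo := go_notMem_halt (K := K) hrej buf eof c
    have hgo' : (.go q buf eof c : (K.sim M).Q) ≠ (K.sim M).query := by simp
    obtain ⟨Z, v, hZ⟩ : ∃ Z v, γ.map some ++ [none] = Z :: v := by
      cases γ <;> simp
    have hfetch : eof = false → (q ∈ M.acc ∨ q ∉ M.halt ∧ buf = none) →
        ∃ c', (K.sim M).Step A ⟨.go q buf eof c, rest, γ.map some ++ [none], s, g⟩ c' := by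
      rintro rfl hq
      rcases rest with _ | ⟨a, rest⟩
      · simp at he
      obtain ⟨⟨c', d⟩, hc'⟩ := K.read_nonempty c a
      rw [hZ]
      exact ⟨_, .read hgo hgo' (.fetch hq hc')⟩
    by_cases hacc : q ∈ M.acc
    · rcases eof with _ | _
      · exact hfetch rfl (.inl hacc)
      · rw [hZ]
        by_cases hc : c ∈ K.final
        · exact ⟨_, .stay hgo hgo' (.ask hacc hc)⟩
        · exact ⟨_, .stay hgo hgo' (.fail hacc hc)⟩
    have hq : q ∉ M.halt := fun h => h.elim hacc hrej
    obtain ⟨c₁, hc₁⟩ := ((hab _ _ _ hm).2).resolve_left hq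
    obtain ⟨-, a, u', Z, v, p, w, o, hu', rfl, htr, rfl⟩ := hc₁.inv
    obtain ⟨⟨c', d, g'⟩, hc'⟩ := K.write_nonempty c o
    rcases a with _ | a
    · exact ⟨_, .stay hgo hgo' (.stay hq htr hc')⟩
    rcases buf with _ | a'
    · refine hfetch ?_ (.inr ⟨hq, rfl⟩)
      rcases eof with _ | _
      · rfl
      · rw [hu hacc, he.1 rfl] at hu'
        cases hu'
    · have := hu hacc
      rw [hu'] at this
      obtain rfl : a = a' := (List.cons.inj this).1
      exact ⟨_, .stay hgo hgo' (.use hq htr hc')⟩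
  | @query _ _ _ _ s _ _ _ _ hn =>
    refine ⟨by omega, .inr ?_⟩
    by_cases hs : s ∈ A
    · exact ⟨_, .ask_yes hs⟩
    · exact ⟨_, .ask_no hs⟩
  | yes _ _ _ _ hn => exact ⟨by omega, .inl (.inl rfl)⟩
  | no hn => exact ⟨by omega, .inl (.inr (.inl rfl))⟩
  | fail hn => exact ⟨by omega, .inl (.inr (.inr (.inl rfl)))⟩

/-- Soundness: an invariant kept by all reactions of the control holds when the query is answered.
-/
theorem exists_of_mem_outputs_sim (hM : M.Terminates) (hI : Preserved K I) {g : List G}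
    (h : g ∈ (K.sim M).outputs A t) :
    ∃ z c s, z ∈ M.outputs (t.filterMap K.proj) ∧ I t z c s g ∧ c ∈ K.final ∧ s ∈ A := by
  obtain ⟨a, b, hab⟩ := hM
  obtain ⟨n, c, hn, hc, rfl⟩ := h
  have hinv := inv_of_stepsIn hI (fun m c h => (hab _ m c h).1) hn
  cases hinv with
  | init => cases hc
  | go => cases hc
  | query => cases hc
  | yes hz hi hf hs => exact ⟨_, _, _, hz, hi, hf, hs⟩
  | no => cases hc
  | fail => cases hc

variable {J : List T → List H → K.C → List D → List G → Prop}

/-- Completeness up to acceptance. Symbols are fetched only when the simulated machine reads, so the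
buffer is empty between its moves. -/
theorem exists_stepsIn_sim (hJ : Preservable K J) {m : ℕ} {c₀ : M.Config}
    (h : StepsIn M.Step (M.init (t.filterMap K.proj)) m c₀) :
    ∃ n eof c used rest s g, tapeOf t = used ++ rest ∧ (eof = true ↔ rest = []) ∧
      c₀.input = rest.filterMap (projTape K.proj) ∧ J (symsOf used) c₀.output c s g ∧
      StepsIn ((K.sim M).Step A) ((K.sim M).init t) n
        ⟨.go c₀.state none eof c, rest, c₀.stack.map some ++ [none], s, g⟩ := by
  induction h with
  | refl =>
    refine ⟨1, false, K.start, [], tapeOf t, [], [], rfl, by simp [tapeOf],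
      (filterMap_projTape_tapeOf _ _).symm, hJ.init, StepsIn.refl.tail ?_⟩
    exact sim_step (.start none) (by simp [OracleNPDA.halt])
  | @tail m c₁ c₂ _ hs ih =>
    obtain ⟨n, eof, c, used, rest, s, g, ht, he, hu, hj, hn⟩ := ih
    obtain ⟨q, u, γ, z⟩ := c₁
    obtain ⟨hq, a, u', Z, v, p, w, o, rfl, rfl, htr, rfl⟩ := hs.inv
    have hq' : q ∉ M.rej := fun h => hq (.inr h)
    have hgo := fun buf eof c => go_notMem_halt (K := K) hq' buf eof c
    rcases a with _ | a
    · obtain ⟨c', d, e, hc', hj'⟩ := hJ.write o hj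
      refine ⟨n + 1, eof, c', used, rest, _, _, ht, he, hu, hj', hn.tail ?_⟩
      rw [List.map_append, List.append_assoc]
      exact sim_step (.stay hq htr hc') (hgo _ _ _)
    · replace hu : a :: u' = rest.filterMap (projTape K.proj) := hu
      -- read the input up to the next symbol that the simulated machine sees
      induction rest generalizing n eof c used s with
      | nil => cases hu
      | cons b rest ih =>
        obtain rfl : eof = false := by simpa using he
        obtain ⟨c', d, hc', hj'⟩ := hJ.read b hj
        have ht' : tapeOf t = (used ++ [b]) ++ rest := by simpa using ht
        have he' := isRight_iff_of_tapeOf_eq ht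
        have hn' := hn
        simp only [List.map_cons, List.cons_append] at hn'
        replace hn' := hn'.tail (sim_step (A := A) (u := rest)
          (v := (v.map some ++ [none])) (.fetch (Z := some Z) (.inr ⟨hq, rfl⟩) hc') (hgo _ _ _))
        simp only [Option.toList_none, List.append_nil] at hn'
        rcases hb : projTape K.proj b with _ | a'
        · rw [hb] at hn'
          rw [List.filterMap_cons_none hb] at hu
          exact ih _ _ _ _ _ ht' he' hj' hn' hu
        · rw [hb] at hn'
          rw [List.filterMap_cons_some hb] at hu
          obtain ⟨rfl, rfl⟩ := List.cons.inj hu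
          obtain ⟨c'', d', e, hc'', hj''⟩ := hJ.write o hj'
          refine ⟨_, b.isRight, c'', used ++ [b], rest, _, _, ht', he', rfl, hj'',
            hn'.tail ?_⟩
          rw [List.map_append, List.append_assoc]
          exact sim_step (.use hq htr hc'') (hgo _ _ _)

theorem exists_mem_outputs_sim (hJ : Preservable K J) {z : List H}
    (hz : z ∈ M.outputs (t.filterMap K.proj))
    (hfin : ∀ c s g, J t z c s g → c ∈ K.final ∧ s ∈ A) :
    ∃ c s g, J t z c s g ∧ g ∈ (K.sim M).outputs A t := by
  obtain ⟨m, ⟨q, u, γ, z⟩, hm, hq, rfl⟩ := hz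
  obtain ⟨n, eof, c, used, rest, s, g, ht, he, -, hj, hn⟩ := exists_stepsIn_sim (A := A) hJ hm
  have hgo := fun buf eof c => go_notMem_halt (K := K) (NPDA.notMem_rej hq) buf eof c
  obtain ⟨Z, v, hZ⟩ : ∃ Z v, γ.map some ++ [none] = Z :: v := by
    cases γ <;> simp
  simp only [hZ] at hn hj
  -- The fetches after acceptance refill the buffer, so the induction needs it arbitrary.
  generalize (none : Option (Tape S)) = buf at hn
  induction rest generalizing n eof c used s buf with
  | nil =>
    obtain rfl : eof = true := he.2 rfl
    obtain rfl : tapeOf t = used := by simpa using ht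
    rw [symsOf_tapeOf] at hj
    obtain ⟨hc, hs⟩ := hfin _ _ _ hj
    refine ⟨c, s, g, hj, n + 1 + 1, ⟨.yes, [], [Z] ++ v, [], g⟩, (hn.tail ?_).tail (.ask_yes hs),
      rfl, rfl⟩
    have := OracleNPDA.Step.stay (A := A) (u := []) (s := s) (y := g) (v := v)
      (hgo buf true c) (by simp) (.ask (Z := Z) hq hc)
    simpa using this
  | cons b rest ih =>
    obtain rfl : eof = false := by simpa using he
    obtain ⟨c', d, hc', hj'⟩ := hJ.read b hj
    have hn' := hn.tail (sim_step (A := A) (u := rest) (.fetch (Z := Z) (.inl hq) hc') (hgo _ _ _))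
    simp only [Option.toList_none, List.append_nil, List.singleton_append] at hn'
    exact ih _ _ _ (used ++ [b]) _ (by simpa using ht) (isRight_iff_of_tapeOf_eq ht) hj' _ hn'

end Controller
end CFLFun

namespace CFLFun

/-! ### Comparing two interleaved strings -/

variable {H : Type}

/-- The symbols tagged with `b`. -/
def track (b : Bool) (s : List (Bool × H)) : List H :=
  s.filterMap fun p => if p.1 = b then some p.2 else none

theorem track_append (b : Bool) (s t : List (Bool × H)) :
    track b (s ++ t) = track b s ++ track b t :=
  List.filterMap_append

theorem track_self (b : Bool) (a : H) : track b [(b, a)] = [a] := by simp [track]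

theorem track_not_self (b : Bool) (a : H) : track (!b) [(b, a)] = [] := by simp [track]

theorem track_self_not (b : Bool) (a : H) : track b [(!b, a)] = [] := by simp [track]

theorem exists_eq_append_of_track_getElem? {b : Bool} {s : List (Bool × H)} {i : ℕ} {a : H}
    (h : (track b s)[i]? = some a) : ∃ u v, s = u ++ (b, a) :: v ∧ (track b u).length = i := by
  induction s generalizing i with
  | nil => simp [track] at h
  | cons p s ih =>
    obtain ⟨b', a'⟩ := p
    rw [← List.singleton_append, track_append] at h
    by_cases hb : b' = b
    · subst hb
      rw [track_self] at h
      rcases i with _ | i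
      · simp at h
        subst h
        exact ⟨[], s, rfl, rfl⟩
      · obtain ⟨u, v, rfl, hu⟩ := ih (by simpa using h)
        refine ⟨(b', a') :: u, v, rfl, ?_⟩
        rw [← List.singleton_append, track_append, track_self]
        simp [hu]
    · obtain rfl : b' = !b := by cases b <;> cases b' <;> simp_all
      rw [track_self_not] at h
      obtain ⟨u, v, rfl, hu⟩ := ih h
      refine ⟨(!b, a') :: u, v, rfl, ?_⟩
      rw [← List.singleton_append, track_append, track_self_not]
      simpa using hu

/-- The interleavings of two different strings. -/
def mismatchLang (H : Type) : Language (Bool × H) := {s | track false s ≠ track true s}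

/-- States of the machine recognizing `mismatchLang H`. -/
inductive MisState (H : Type) : Type
  | count : MisState H
  | find (b : Bool) (a : H) : MisState H
  | accept : MisState H
  | reject : MisState H
  | query : MisState H
  | yes : MisState H
  | no : MisState H

instance MisState.finite [Finite H] : Finite (MisState H) := by
  refine Finite.of_injective (fun s : MisState H => match s with
      | .count => (.inl 0 : Fin 6 ⊕ (Bool × H))
      | .accept => .inl 1
      | .reject => .inl 2
      | .query => .inl 3
      | .yes => .inl 4
      | .no => .inl 5
      | .find b a => .inr (b, a)) ?_
  intro s t h
  cases s <;> cases t <;> simp_all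

/-- Moves of the machine recognizing `mismatchLang H`.  It counts on its stack by how many symbols
one track is ahead of the other, guesses a symbol of the track that is ahead, and compares it
with the symbol at the same position of the other track. -/
inductive MisMove : MisState H → Option (Tape (Bool × H)) → Option Bool →
    MisState H × List (Option Bool) × Option Empty × Option Empty → Prop
  | left (Z : Option Bool) : MisMove .count (some .left) Z (.count, [Z], none, none)
  | pop (b : Bool) (a : H) : MisMove .count (some (.sym (b, a))) (some !b) (.count, [], none, none)
  | push {b : Bool} (a : H) {Z : Option Bool} : Z ≠ some !b →
      MisMove .count (some (.sym (b, a))) Z (.count, [some b, Z], none, none)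
  | guess {b : Bool} (a : H) {Z : Option Bool} : Z ≠ some !b →
      MisMove .count (some (.sym (b, a))) Z (.find b a, [Z], none, none)
  | length_ne {Z : Option Bool} : Z ≠ none →
      MisMove .count (some .right) Z (.accept, [Z], none, none)
  | length_eq : MisMove .count (some .right) none (.reject, [none], none, none)
  | skip (b : Bool) (a a' : H) (Z : Option Bool) :
      MisMove (.find b a) (some (.sym (b, a'))) Z (.find b a, [Z], none, none)
  | down (b : Bool) (a a' : H) (Y : Bool) :
      MisMove (.find b a) (some (.sym (!b, a'))) (some Y) (.find b a, [], none, none)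
  | hit (b : Bool) {a a' : H} : a' ≠ a →
      MisMove (.find b a) (some (.sym (!b, a'))) none (.accept, [none], none, none)
  | miss (b : Bool) (a : H) :
      MisMove (.find b a) (some (.sym (!b, a))) none (.reject, [none], none, none)
  | finish (b : Bool) (a : H) (Z : Option Bool) :
      MisMove (.find b a) (some .right) Z (.reject, [Z], none, none)

/-- The machine recognizing `mismatchLang H`; it asks no queries. -/
abbrev misNPDA (H : Type) [Finite H] : OracleNPDA (Bool × H) Empty Empty where
  Q := MisState H
  Stk := Option Bool
  finQ := inferInstance
  finStk := inferInstance
  start := .count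
  bottom := none
  acc := {.accept}
  rej := {.reject}
  disj := by simp
  query := .query
  yes := .yes
  no := .no
  query_ne_yes := by simp
  query_ne_no := by simp
  yes_ne_no := by simp
  query_notMem := by simp
  trans q a Z := {r | MisMove q a Z r}
  finTrans q a Z := by
    refine ((Set.finite_univ (α := MisState H)).prod
      ((List.finite_length_le (Option Bool) 2).prod
        (Set.finite_univ (α := Option Empty × Option Empty)))).subset ?_
    rintro ⟨p, w, d, g⟩ h
    refine ⟨trivial, ?_, trivial⟩
    change w.length ≤ 2
    cases h <;> simp

/-- The stack with `k` symbols `b` above the bottom symbol. -/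
def counter (b : Bool) (k : ℕ) : List (Option Bool) := List.replicate k (some b) ++ [none]

theorem counter_succ (b : Bool) (k : ℕ) : counter b (k + 1) = some b :: counter b k := rfl

/-- What is known after `n` steps on input `s`. -/
inductive MisInv [Finite H] (s : List (Bool × H)) : ℕ → (misNPDA H).Config → Prop
  | init : MisInv s 0 ((misNPDA H).init s)
  | count {n k : ℕ} {b : Bool} {u v : List (Bool × H)} : s = u ++ v →
      (track b u).length = (track (!b) u).length + k → n = u.length + 1 →
      MisInv s n ⟨.count, v.map .sym ++ [.right], counter b k, [], []⟩
  | find {n k : ℕ} {b : Bool} {a : H} {u v : List (Bool × H)} : s = u ++ v →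
      -- The marked symbol stands `k` places beyond what has been read of the other track; each
      -- symbol of that track pops one, and at `k = 0` the next one is its partner.
      (track b u)[(track (!b) u).length + k]? = some a → n = u.length + 1 →
      MisInv s n ⟨.find b a, v.map .sym ++ [.right], counter b k, [], []⟩
  | accept {n : ℕ} {u : List (Tape (Bool × H))} {v : List (Option Bool)} {d g : List Empty} :
      s ∈ mismatchLang H → n ≤ s.length + 2 → MisInv s n ⟨.accept, u, v, d, g⟩
  | reject {n : ℕ} {u : List (Tape (Bool × H))} {v : List (Option Bool)} {d g : List Empty} :
      n ≤ s.length + 2 → MisInv s n ⟨.reject, u, v, d, g⟩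

theorem mem_mismatchLang_of_getElem? {s : List (Bool × H)} {b : Bool} {i : ℕ}
    (h : (track b s)[i]? ≠ (track (!b) s)[i]?) : s ∈ mismatchLang H := by
  intro he
  cases b
  · exact h (by rw [he]; rfl)
  · exact h (by rw [← he]; rfl)

theorem mem_mismatchLang_of_length {s : List (Bool × H)} {b : Bool}
    (h : (track b s).length ≠ (track (!b) s).length) : s ∈ mismatchLang H := by
  intro he
  cases b
  · exact h (by rw [he]; rfl)
  · exact h (by rw [← he]; rfl)

theorem exists_misMove_count (b : Bool) (a : H) (Z : Option Bool) :
    ∃ w, MisMove .count (some (.sym (b, a))) Z (.count, w, none, none) := by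
  by_cases h : Z = some !b
  · subst h
    exact ⟨_, .pop b a⟩
  · exact ⟨_, .push a h⟩

variable [Finite H] {A : Language Empty} {s : List (Bool × H)} {n : ℕ}

theorem MisInv.step {c c' : (misNPDA H).Config} (h : MisInv s n c)
    (hs : (misNPDA H).Step A c c') : MisInv s (n + 1) c' := by
  cases h with
  | init =>
    obtain ⟨-, -, a, u', Z, v, p, w, d, o, hu, hγ, ht, rfl⟩ | ⟨h, -⟩ := hs.inv
    swap
    · cases h
    obtain ⟨rfl, rfl⟩ := List.cons.inj hγ
    rcases a with _ | a
    · cases ht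
    obtain ⟨rfl, rfl⟩ := List.cons.inj hu
    cases ht
    exact .count (b := true) (k := 0) (u := []) rfl rfl rfl
  | @count _ k b u v hs' hk hn =>
    obtain ⟨-, -, a, u', Z, γ, p, w, d, o, hu, hγ, ht, rfl⟩ | ⟨h, -⟩ := hs.inv
    swap
    · cases h
    rcases a with _ | a
    · cases ht
    have hlen := congrArg List.length hs'
    rw [List.length_append] at hlen
    rcases v with _ | ⟨⟨b', a'⟩, v⟩
    · obtain ⟨rfl, rfl⟩ := List.cons.inj hu
      rw [List.append_nil] at hs'
      subst hs'
      cases ht with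
      | length_ne hZ =>
        refine .accept ?_ (by omega)
        rcases k with _ | k
        · exact absurd (List.cons.inj hγ).1.symm hZ
        · exact mem_mismatchLang_of_length (b := b) (by omega)
      | length_eq => exact .reject (by omega)
    obtain ⟨rfl, rfl⟩ := List.cons.inj hu
    have hs'' : s = (u ++ [(b', a')]) ++ v := by simpa using hs'
    have hnext : ∀ {k'}, (track b' u).length = (track (!b') u).length + k' →
        MisInv s (n + 1) ⟨.count, v.map .sym ++ [.right], some b' :: counter b' k', [], []⟩ := by
      intro k' h
      rw [← counter_succ]
      refine .count hs'' ?_ (by simp [hn])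
      rw [track_append, track_append, track_self, track_not_self]
      simp
      omega
    -- A top symbol other than `!b'` means that track `b'` is not behind. At `k = 0` the stack does
    -- not determine `b`, so the label can be switched.
    have hb : Z ≠ some !b' → ∃ k', (track b' u).length = (track (!b') u).length + k' ∧
        counter b k = counter b' k' := by
      intro hZ
      rcases k with _ | k
      · refine ⟨0, ?_, rfl⟩
        cases b <;> cases b' <;> simp_all
      · have hZ' : some b = Z := (List.cons.inj hγ).1
        obtain rfl : b = b' := by
          subst hZ'
          cases b <;> cases b' <;> simp_all
        exact ⟨_, hk, rfl⟩
    cases ht with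
    | pop =>
      rcases k with _ | k
      · cases (List.cons.inj hγ).1
      · obtain ⟨h₁, rfl⟩ := List.cons.inj hγ
        obtain rfl : b = !b' := Option.some.inj h₁
        refine .count hs'' ?_ (by simp [hn])
        rw [Bool.not_not] at hk ⊢
        rw [track_append, track_append, track_self, track_not_self]
        simp
        omega
    | push _ hZ =>
      obtain ⟨k', h₁, h₂⟩ := hb hZ
      have := hnext h₁
      rw [← h₂, hγ] at this
      exact this
    | guess _ hZ =>
      obtain ⟨k', h₁, h₂⟩ := hb hZ
      rw [List.singleton_append, ← hγ, h₂]
      refine .find hs'' ?_ (by simp [hn])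
      rw [track_append, track_append, track_self, track_not_self]
      simp [h₁]
  | @find _ k b a₀ u v hs' hk hn =>
    obtain ⟨-, -, a, u', Z, γ, p, w, d, o, hu, hγ, ht, rfl⟩ | ⟨h, -⟩ := hs.inv
    swap
    · cases h
    rcases a with _ | a
    · cases ht
    have hlen := congrArg List.length hs'
    rw [List.length_append] at hlen
    rcases v with _ | ⟨⟨b', a'⟩, v⟩
    · obtain ⟨rfl, rfl⟩ := List.cons.inj hu
      cases ht
      exact .reject (by omega)
    obtain ⟨rfl, rfl⟩ := List.cons.inj hu
    have hs'' : s = (u ++ [(b', a')]) ++ v := by simpa using hs'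
    rw [List.length_cons] at hlen
    have hk' : ∀ w, (track b (u ++ w))[(track (!b) u).length + k]? = some a₀ := by
      intro w
      rw [track_append, List.getElem?_append_left, hk]
      exact (List.getElem?_eq_some_iff.1 hk).1
    cases ht with
    | skip =>
      rw [List.singleton_append, ← hγ]
      refine .find hs'' ?_ (by simp [hn])
      rw [track_append (!b), track_not_self, List.append_nil]
      exact hk' _
    | down =>
      rcases k with _ | k
      · cases (List.cons.inj hγ).1
      obtain ⟨-, rfl⟩ := List.cons.inj hγ
      refine .find hs'' ?_ (by simp [hn])
      rw [track_append (!b), track_self, List.length_append, ← hk' [(!b, a')]]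
      congr 1
      simp
      omega
    | hit _ hne =>
      rcases k with _ | k
      swap
      · cases (List.cons.inj hγ).1
      refine .accept (mem_mismatchLang_of_getElem? (b := b) (i := (track (!b) u).length) ?_)
        (by omega)
      have h₁ := hk' ((!b, a') :: v)
      rw [← hs', Nat.add_zero] at h₁
      rw [h₁, hs'', track_append, track_append, track_self]
      simpa using hne.symm
    | miss => exact .reject (by omega)
  | accept =>
    obtain ⟨h, -⟩ | ⟨h, -⟩ := hs.inv
    · exact absurd (.inl rfl) h
    · cases h
  | reject =>
    obtain ⟨h, -⟩ | ⟨h, -⟩ := hs.inv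
    · exact absurd (.inr rfl) h
    · cases h

theorem misInv_of_stepsIn {c : (misNPDA H).Config}
    (h : StepsIn ((misNPDA H).Step A) ((misNPDA H).init s) n c) : MisInv s n c := by
  induction h with
  | refl => exact .init
  | tail _ hs ih => exact ih.step hs

theorem misNPDA_step {q p : MisState H} {a : Tape (Bool × H)} {u : List (Tape (Bool × H))}
    {Z : Option Bool} {v w : List (Option Bool)} (h : MisMove q (some a) Z (p, w, none, none)) :
    (misNPDA H).Step A ⟨q, a :: u, Z :: v, [], []⟩ ⟨p, u, w ++ v, [], []⟩ := by
  refine OracleNPDA.Step.read (M := misNPDA H) (s := []) (y := []) ?_ ?_ h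
  · rintro (rfl | rfl) <;> cases h
  · rintro rfl
    cases h

theorem misNPDA_terminates : (misNPDA H).Terminates := by
  refine ⟨1, 2, fun A s n c h => ?_⟩
  have hcons : ∀ b k, ∃ Z v, counter b k = Z :: v := by
    rintro b (_ | k)
    · exact ⟨_, _, rfl⟩
    · exact ⟨_, _, rfl⟩
  cases misInv_of_stepsIn h with
  | init => exact ⟨by omega, .inr ⟨_, misNPDA_step (.left none)⟩⟩
  | @count _ k b u v hs hk hn =>
    have hlen := congrArg List.length hs
    rw [List.length_append] at hlen
    refine ⟨by omega, .inr ?_⟩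
    obtain ⟨Z, γ, hγ⟩ := hcons b k
    rw [hγ]
    rcases v with _ | ⟨⟨b', a'⟩, v⟩
    · by_cases hZ : Z = none
      · subst hZ
        exact ⟨_, misNPDA_step .length_eq⟩
      · exact ⟨_, misNPDA_step (.length_ne hZ)⟩
    · obtain ⟨w, hw⟩ := exists_misMove_count b' a' Z
      exact ⟨_, misNPDA_step hw⟩
  | @find _ k b a u v hs hk hn =>
    have hlen := congrArg List.length hs
    rw [List.length_append] at hlen
    refine ⟨by omega, .inr ?_⟩
    obtain ⟨Z, γ, hγ⟩ := hcons b k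
    rw [hγ]
    rcases v with _ | ⟨⟨b', a'⟩, v⟩
    · exact ⟨_, misNPDA_step (.finish b a Z)⟩
    · obtain rfl | rfl : b' = b ∨ b' = !b := by cases b <;> cases b' <;> simp
      · exact ⟨_, misNPDA_step (.skip b' a a' Z)⟩
      · rcases Z with _ | Y
        · by_cases ha : a' = a
          · subst ha
            exact ⟨_, misNPDA_step (.miss b a')⟩
          · exact ⟨_, misNPDA_step (.hit b ha)⟩
        · exact ⟨_, misNPDA_step (.down b a a' Y)⟩
  | accept _ hn => exact ⟨by omega, .inl (.inl rfl)⟩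
  | reject hn => exact ⟨by omega, .inl (.inr rfl)⟩

theorem misNPDA_count (u : List (Bool × H)) : ∀ v, ∃ n b k,
    (track b u).length = (track (!b) u).length + k ∧
    StepsIn ((misNPDA H).Step A) ((misNPDA H).init (u ++ v)) n
      ⟨.count, v.map .sym ++ [.right], counter b k, [], []⟩ := by
  induction u using List.reverseRecOn with
  | nil => exact fun v => ⟨1, true, 0, rfl, StepsIn.refl.tail (misNPDA_step (.left none))⟩
  | append_singleton u x ih =>
    intro v
    obtain ⟨n, b, k, hk, hn⟩ := ih (x :: v)
    obtain ⟨b', a'⟩ := x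
    obtain ⟨Z, γ, hγ⟩ : ∃ Z v, counter b k = Z :: v := by
      rcases k with _ | k <;> exact ⟨_, _, rfl⟩
    obtain ⟨w, hw⟩ := exists_misMove_count b' a' Z
    rw [hγ] at hn
    have hn' := hn.tail (misNPDA_step (u := v.map .sym ++ [.right]) (v := γ) hw)
    -- The invariant identifies the configuration reached, which spares a case analysis of the
    -- counter.
    have hinv := misInv_of_stepsIn hn'
    generalize hc : (⟨.count, v.map .sym ++ [.right], w ++ γ, [], []⟩ : (misNPDA H).Config) = c
      at hn' hinv
    cases hinv with
    | @count _ k b u' v' hs hk =>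
      simp only [OracleNPDA.Config.mk.injEq, true_and, and_true, List.append_cancel_right_eq] at hc
      obtain ⟨hv, hw⟩ := hc
      obtain rfl : v = v' := List.map_injective_iff.2 (fun _ _ h => Tape.sym.inj h) hv
      obtain rfl : u ++ [(b', a')] = u' := by
        rw [← List.singleton_append, ← List.append_assoc] at hs
        exact List.append_cancel_right hs
      refine ⟨n + 1, b, k, hk, ?_⟩
      rw [List.append_assoc]
      exact hn'
    | _ => simp at hc

theorem misNPDA_find {b : Bool} {a a' : H} (ha : a' ≠ a) (v : List (Bool × H)) : ∀ k,
    (track (!b) v)[k]? = some a' → ∃ n u γ,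
      StepsIn ((misNPDA H).Step A) ⟨.find b a, v.map .sym ++ [.right], counter b k, [], []⟩ n
        ⟨.accept, u, γ, [], []⟩ := by
  induction v with
  | nil => simp [track]
  | cons x v ih =>
    intro k hk
    obtain ⟨b', a₁⟩ := x
    rw [← List.singleton_append, track_append] at hk
    obtain rfl | rfl : b' = b ∨ b' = !b := by cases b <;> cases b' <;> simp
    · rw [track_not_self] at hk
      obtain ⟨n, u, γ, hn⟩ := ih k hk
      obtain ⟨Z, δ, hγ⟩ : ∃ Z v, counter b' k = Z :: v := by
        rcases k with _ | k <;> exact ⟨_, _, rfl⟩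
      refine ⟨n + 1, u, γ, StepsIn.head ?_ hn⟩
      rw [hγ]
      exact misNPDA_step (.skip b' a a₁ Z)
    · rw [track_self] at hk
      rcases k with _ | k
      · obtain rfl : a₁ = a' := by simpa using hk
        exact ⟨1, _, _, StepsIn.refl.tail (misNPDA_step (.hit b ha))⟩
      · obtain ⟨n, u, γ, hn⟩ := ih k (by simpa using hk)
        refine ⟨n + 1, u, γ, StepsIn.head ?_ hn⟩
        exact misNPDA_step (.down b a a₁ b)

/-- Since track `b` is not behind when `a` is guessed, the symbol at the same position of the other
track is still unread and can be compared later. -/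
theorem misNPDA_accepts_of_ahead {b : Bool} {a a' : H} (ha : a' ≠ a) {u v : List (Bool × H)}
    (hle : (track (!b) u).length ≤ (track b u).length)
    (ha' : (track (!b) (u ++ (b, a) :: v))[(track b u).length]? = some a') :
    (misNPDA H).Accepts A (u ++ (b, a) :: v) := by
  obtain ⟨n, b₀, k, hk, hn⟩ := misNPDA_count (A := A) u ((b, a) :: v)
  obtain ⟨k', hk', hc⟩ : ∃ k', (track b u).length = (track (!b) u).length + k' ∧
      counter b₀ k = counter b k' := by
    obtain rfl | rfl : b₀ = b ∨ b₀ = !b := by cases b <;> cases b₀ <;> simp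
    · exact ⟨k, hk, rfl⟩
    · rw [Bool.not_not] at hk
      obtain rfl : k = 0 := by omega
      exact ⟨0, by omega, rfl⟩
  rw [hc] at hn
  have hv : (track (!b) v)[k']? = some a' := by
    rw [track_append, List.getElem?_append_right hle, ← List.singleton_append, track_append,
      track_not_self] at ha'
    rw [← ha', hk']
    simp
  obtain ⟨m, w, γ, hm⟩ := misNPDA_find (A := A) ha v k' hv
  obtain ⟨Z, δ, hγ, hZ⟩ : ∃ Z v, counter b k' = Z :: v ∧ Z ≠ some !b := by
    rcases k' with _ | k'
    · exact ⟨_, _, rfl, by simp⟩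
    · exact ⟨_, _, rfl, by simp⟩
  rw [hγ] at hn hm
  exact ⟨_, _, (hn.tail (misNPDA_step (.guess a hZ))).trans hm, rfl⟩

theorem misNPDA_accepts_iff : (misNPDA H).Accepts A s ↔ s ∈ mismatchLang H := by
  constructor
  · rintro ⟨n, c, hn, hc⟩
    cases misInv_of_stepsIn hn with
    | accept h => exact h
    | init => cases hc
    | count => cases hc
    | find => cases hc
    | reject => cases hc
  · intro h
    by_cases hlen : (track false s).length = (track true s).length
    · obtain ⟨i, hi⟩ : ∃ i, (track false s)[i]? ≠ (track true s)[i]? := by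
        by_contra! hcon
        exact h (List.ext_getElem? hcon)
      have hi₀ : i < (track false s).length := by
        by_contra hge
        rw [List.getElem?_eq_none (by omega), List.getElem?_eq_none (by omega)] at hi
        exact hi rfl
      obtain ⟨a₀, ha₀⟩ : ∃ a, (track false s)[i]? = some a := ⟨_, List.getElem?_eq_getElem hi₀⟩
      obtain ⟨a₁, ha₁⟩ : ∃ a, (track true s)[i]? = some a :=
        ⟨_, List.getElem?_eq_getElem (hlen ▸ hi₀)⟩
      have hne : a₁ ≠ a₀ := by
        rintro rfl
        exact hi (ha₀.trans ha₁.symm)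
      obtain ⟨u, v, hs, hu⟩ := exists_eq_append_of_track_getElem? ha₀
      obtain ⟨u', v', hs', hu'⟩ := exists_eq_append_of_track_getElem? ha₁
      -- Of the two symbols at position `i`, the machine must guess the one that occurs first in the
      -- interleaving.
      by_cases hle : (track true u).length ≤ i
      · rw [hs]
        refine misNPDA_accepts_of_ahead hne (hu ▸ hle) ?_
        rw [hu, ← hs]
        exact ha₁
      · obtain ⟨w, rfl⟩ : u' <+: u := by
          rcases List.prefix_or_prefix_of_prefix (l₃ := s) ⟨_, hs'.symm⟩ ⟨_, hs.symm⟩ with h | h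
          · exact h
          · obtain ⟨w, rfl⟩ := h
            rw [track_append, List.length_append] at hu'
            omega
        rw [hs']
        refine misNPDA_accepts_of_ahead hne.symm ?_ ?_
        · rw [track_append, List.length_append] at hu
          simp only [Bool.not_true]
          omega
        · rw [hu', ← hs']
          exact ha₀
    · obtain ⟨n, b, k, hk, hn⟩ := misNPDA_count (A := A) s []
      rcases k with _ | k
      · exact absurd hk (by cases b <;> simp <;> omega)
      · rw [List.append_nil] at hn
        exact ⟨_, _, hn.tail (misNPDA_step (.length_ne (by simp))), rfl⟩

theorem isContextFree_zero (T : Type) : (0 : Language T).IsContextFree :=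
  ⟨⟨Unit, (), ∅⟩, ContextFreeGrammar.language_eq_zero_of_forall_input_ne_initial (by simp)⟩

/-- The interleavings of a string with itself form a language in `Π_2^CFL`. -/
theorem match_mem_PiCFL (H : Type) [Finite H] :
    (⟨Bool × H, inferInstance, (mismatchLang H)ᶜ⟩ : Lang) ∈ PiCFL 2 := by
  -- The machine asks nothing, so any oracle in `PiCFL 1` serves; this one is the complement of the
  -- empty language.
  refine ⟨⟨Empty, inferInstance, (0 : Language Empty)ᶜ⟩, ?_, misNPDA H, misNPDA_terminates,
    fun x => ?_⟩
  · change ((0 : Language Empty)ᶜᶜ).IsContextFree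
    rw [compl_compl]
    exact isContextFree_zero Empty
  · change x ∈ (mismatchLang H)ᶜᶜ ↔ _
    rw [compl_compl]
    exact misNPDA_accepts_iff.symm

end CFLFun

namespace CFLFun

/-! ### Optimal outputs -/

variable {S H : Type}

/-- A mark in the string `y` after its prefix `p`: either `p` is `y` or the mark is the next
symbol. -/
def Marked (m : Option H) (p y : List H) : Prop := p <+: y ∧ m = y[p.length]?

/-- Reactions to a symbol `a` of the string that goes to track `b`: before the mark is set, `a` is
either copied or marked, and afterwards `a` is ignored. -/
def markMove (b : Bool) : Option H → H → Set (Option H × Option (Bool × H))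
  | none, a => {(none, some (b, a)), (some a, none)}
  | some c, _ => {(some c, none)}

theorem markMove_nonempty (b : Bool) (m : Option H) (a : H) : (markMove b m a).Nonempty := by
  cases m
  · exact Set.insert_nonempty _ _
  · exact Set.singleton_nonempty _

theorem track_not_of_mem_markMove {b : Bool} {m m' : Option H} {a : H} {d : Option (Bool × H)}
    (h : (m', d) ∈ markMove b m a) : track (!b) d.toList = [] := by
  rcases m with _ | c
  · rcases h with h | h <;> cases h
    · exact track_not_self b a
    · rfl
  · cases Set.mem_singleton_iff.1 h
    rfl

/-- If `p` is all of `y`, no mark is set and `a` is copied or marked; otherwise the mark is set and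
both it and `p` stay fixed. -/
theorem Marked.markMove {b : Bool} {m m' : Option H} {p y : List H} {a : H}
    {d : Option (Bool × H)} (h : Marked m p y) (hm : (m', d) ∈ markMove b m a) :
    Marked m' (p ++ track b d.toList) (y ++ [a]) := by
  obtain ⟨⟨r, rfl⟩, rfl⟩ := h
  rcases r with _ | ⟨c, r⟩
  · simp only [List.append_nil, List.getElem?_length] at hm ⊢
    rcases hm with h | h <;> cases h
    · rw [Option.toList_some, track_self]
      exact ⟨List.prefix_refl _, by simp⟩
    · exact ⟨by simp [track], by simp [track]⟩
  · simp only [List.getElem?_append_right le_rfl, Nat.sub_self, List.getElem?_cons_zero] at hm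
    cases Set.mem_singleton_iff.1 hm
    exact ⟨by simp [track], by simp [track]⟩

/-- The strategy that marks exactly position `i`: copy before it, mark at it, ignore after it. A
string of length at most `i` is copied entirely and stays unmarked. -/
theorem exists_markMove (b : Bool) (i : ℕ) (y : List H) (a : H) :
    ∃ m d, (m, d) ∈ markMove b y[i]? a ∧ m = (y ++ [a])[i]? ∧
      y.take i ++ track b d.toList = (y ++ [a]).take i := by
  rcases lt_trichotomy i y.length with h | rfl | h
  · refine ⟨y[i]?, none, ?_, ?_, ?_⟩
    · rw [List.getElem?_eq_getElem h]
      rfl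
    · rw [List.getElem?_append_left h]
    · rw [List.take_append_of_le_length h.le]
      simp [track]
  · exact ⟨some a, none, by simp [markMove], by simp, by simp [track]⟩
  · refine ⟨none, some (b, a), ?_, ?_, ?_⟩
    · rw [List.getElem?_eq_none h.le]
      exact .inl rfl
    · rw [List.getElem?_eq_none]
      simpa using h
    · rw [Option.toList_some, track_self, List.take_of_length_le h.le, List.take_of_length_le]
      simpa using h

/-- `Beats R y z`: at the first place where `y` and `z` differ, their symbols (or `none`, at the end
of the string) are related by `R`. -/
def Beats (R : Set (Option H × Option H)) (y z : List H) : Prop :=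
  ∃ i, y.take i = z.take i ∧ (y[i]?, z[i]?) ∈ R

/-- The control that guesses an output `z` with `Beats R y z`, where the input consists of `y`
interleaved with the input of the simulated machine. -/
def beatsController (S : Type) [Finite H] (R : Set (Option H × Option H)) :
    Controller S H (S ⊕ H) (Bool × H) Empty where
  C := Option H × Option H
  finC := inferInstance
  start := (none, none)
  proj := Sum.getLeft?
  onRead c t := match t with
    | .inl _ => {(c, none)}
    | .inr a => (fun r => ((r.1, c.2), r.2)) '' markMove false c.1 a
  onWrite c a := (fun r => ((c.1, r.1), r.2, none)) '' markMove true c.2 a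
  onRead_nonempty c t := by
    rcases t with _ | a
    · exact Set.singleton_nonempty _
    · exact (markMove_nonempty _ _ _).image _
  onWrite_nonempty c a := (markMove_nonempty _ _ _).image _
  final := R

/-- The control that copies the input and the output of the simulated machine to the query
tape. -/
def copyController (S H : Type) : Controller S H S (S ⊕ H) H where
  C := Unit
  finC := inferInstance
  start := ()
  proj := some
  onRead _ s := {((), some (.inl s))}
  onWrite _ h := {((), some (.inr h), some h)}
  onRead_nonempty _ _ := Set.singleton_nonempty _
  onWrite_nonempty _ _ := Set.singleton_nonempty _
  final := Set.univ

/-- The invariant of `copyController`. -/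
def CopyInv (u : List S) (z : List H) (s : List (S ⊕ H)) (g : List H) : Prop :=
  s.filterMap Sum.getLeft? = u ∧ s.filterMap Sum.getRight? = z ∧ g = z

theorem copyController_preserved :
    (copyController S H).Preserved fun u z _ s g => CopyInv u z s g where
  init := ⟨rfl, rfl, rfl⟩
  onRead := by
    rintro u z c s g t c' d ⟨rfl, rfl, rfl⟩ h
    cases Set.mem_singleton_iff.1 h
    exact ⟨by simp, by simp, rfl⟩
  onWrite := by
    rintro u z c s g t c' d o ⟨rfl, rfl, rfl⟩ h
    cases Set.mem_singleton_iff.1 h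
    exact ⟨by simp, by simp, by simp⟩

theorem copyController_preservable :
    (copyController S H).Preservable fun u z _ s g => CopyInv u z s g where
  init := ⟨rfl, rfl, rfl⟩
  onRead _ h := ⟨_, _, rfl, copyController_preserved.onRead (c := ()) h rfl⟩
  onWrite _ h := ⟨_, _, _, rfl, copyController_preserved.onWrite (c := ()) h rfl⟩

/-- Comparison of the symbols at the first place where two strings differ. -/
def lexRel (r : H → H → Prop) : Option H → Option H → Prop
  | none, some _ => True
  | some a, some b => r a b
  | _, none => False

theorem lex_iff_exists_take_eq {r : H → H → Prop} {y z : List H} :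
    List.Lex r y z ↔ ∃ i, y.take i = z.take i ∧ lexRel r y[i]? z[i]? := by
  constructor
  · intro h
    induction h with
    | nil => exact ⟨0, rfl, trivial⟩
    | cons _ ih =>
      obtain ⟨i, h₁, h₂⟩ := ih
      exact ⟨i + 1, by simp [h₁], by simpa using h₂⟩
    | rel h => exact ⟨0, rfl, h⟩
  · rintro ⟨i, h₁, h₂⟩
    induction i generalizing y z with
    | zero =>
      rcases y with _ | ⟨a, y⟩ <;> rcases z with _ | ⟨b, z⟩
      · exact h₂.elim
      · exact .nil
      · exact h₂.elim
      · exact .rel h₂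
    | succ i ih =>
      rcases y with _ | ⟨a, y⟩ <;> rcases z with _ | ⟨b, z⟩
      · exact h₂.elim
      · cases h₁
      · cases h₁
      · obtain ⟨rfl, h₃⟩ := List.cons.inj h₁
        exact .cons (ih h₃ (by simpa using h₂))

variable [Finite H]

/-- Whatever the guesses, each track holds a prefix followed in its string by the mark. If the
tracks agree, their common length is a witness for `Beats`. -/
theorem beatsController_preserved (R : Set (Option H × Option H)) :
    (beatsController S R).Preserved fun u z c s _ =>
      Marked c.1 (track false s) (u.filterMap Sum.getRight?) ∧ Marked c.2 (track true s) z where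
  init := ⟨⟨List.prefix_refl _, rfl⟩, ⟨List.prefix_refl _, rfl⟩⟩
  onRead := by
    rintro u z c s g (t | t) c' d ⟨h₁, h₂⟩ h
    · cases Set.mem_singleton_iff.1 h
      rw [List.filterMap_append, Option.toList_none, List.append_nil]
      exact ⟨(List.append_nil (u.filterMap Sum.getRight?)).symm ▸ h₁, h₂⟩
    · obtain ⟨⟨m, d⟩, hm, h⟩ := h
      cases h
      have h₃ := track_not_of_mem_markMove hm
      simp only [Bool.not_false] at h₃
      refine ⟨?_, ?_⟩
      · rw [track_append, List.filterMap_append]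
        exact h₁.markMove hm
      · rw [track_append, h₃, List.append_nil]
        exact h₂
  onWrite := by
    rintro u z c s g t c' d o ⟨h₁, h₂⟩ ⟨⟨m, d⟩, hm, h⟩
    cases h
    have h₃ := track_not_of_mem_markMove hm
    simp only [Bool.not_true] at h₃
    refine ⟨?_, ?_⟩
    · rw [track_append, h₃, List.append_nil]
      exact h₁
    · rw [track_append]
      exact h₂.markMove hm

theorem beatsController_preservable (R : Set (Option H × Option H)) (i : ℕ) :
    (beatsController S R).Preservable fun u z c s _ =>
      c = ((u.filterMap Sum.getRight?)[i]?, z[i]?) ∧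
        track false s = (u.filterMap Sum.getRight?).take i ∧ track true s = z.take i where
  init := by
    refine ⟨?_, ?_, ?_⟩
    · simp [beatsController]
    · simp [track]
    · simp [track]
  onRead := by
    rintro u z c s g (t | t) ⟨rfl, h₁, h₂⟩
    · refine ⟨_, none, rfl, ?_⟩
      have hu : (u ++ [Sum.inl t]).filterMap Sum.getRight? = u.filterMap Sum.getRight? := by simp
      rw [hu, Option.toList_none, List.append_nil]
      exact ⟨rfl, h₁, h₂⟩
    · obtain ⟨m, d, hm, hm', hd⟩ := exists_markMove false i (u.filterMap Sum.getRight?) t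
      have h₃ := track_not_of_mem_markMove hm
      simp only [Bool.not_false] at h₃
      refine ⟨_, _, ⟨⟨m, d⟩, hm, rfl⟩, ?_, ?_, ?_⟩
      · rw [hm', List.filterMap_append]
        rfl
      · rw [track_append, h₁, hd]
        simp
      · rw [track_append, h₃, List.append_nil, h₂]
  onWrite := by
    rintro u z c s g t ⟨rfl, h₁, h₂⟩
    obtain ⟨m, d, hm, hm', hd⟩ := exists_markMove true i z t
    have h₃ := track_not_of_mem_markMove hm
    simp only [Bool.not_true] at h₃
    refine ⟨_, _, _, ⟨⟨m, d⟩, hm, rfl⟩, ?_, ?_, ?_⟩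
    · rw [hm']
    · rw [track_append, h₃, List.append_nil, h₁]
    · rw [track_append, h₂, hd]

/-! ### Unbeaten outputs and the two inclusions -/

variable [Finite S]

/-- Inputs `x` of `M` interleaved with a string `y` that is beaten by an output of `M` on `x`. -/
def beatenLang (M : NPDA S H) (R : Set (Option H × Option H)) : Language (S ⊕ H) :=
  {t | ∃ z ∈ M.outputs (t.filterMap Sum.getLeft?), Beats R (t.filterMap Sum.getRight?) z}

/-- The oracle certifies that the copied prefixes agree, and the final control states check that the
marks behind them are related by `R`. -/
theorem accepts_sim_beatsController_iff {M : NPDA S H} (hM : M.Terminates)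
    {R : Set (Option H × Option H)} {t : List (S ⊕ H)} :
    ((beatsController S R).sim M).Accepts (mismatchLang H)ᶜ t ↔ t ∈ beatenLang M R := by
  constructor
  · rintro ⟨n, c, hn, hc⟩
    obtain ⟨z, c, s, hz, ⟨h₁, h₂⟩, hf, hs⟩ := Controller.exists_of_mem_outputs_sim hM
      (beatsController_preserved R) ⟨n, c, hn, hc, rfl⟩
    have hs' : track false s = track true s := not_not.1 hs
    refine ⟨z, hz, (track false s).length, ?_, ?_⟩
    · rw [← List.prefix_iff_eq_take.1 h₁.1, hs', ← List.prefix_iff_eq_take.1 h₂.1]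
    · rw [← h₁.2, hs', ← h₂.2]
      exact hf
  · rintro ⟨z, hz, i, hi, hR⟩
    obtain ⟨c, s, g, -, n, c', hn, hc', -⟩ := Controller.exists_mem_outputs_sim
      (A := (mismatchLang H)ᶜ) (beatsController_preservable R i) hz (by
        rintro c s g ⟨rfl, h₁, h₂⟩
        refine ⟨hR, fun h => h ?_⟩
        rw [h₁, h₂]
        exact hi)
    exact ⟨n, c', hn, hc'⟩

theorem beatenLang_compl_mem_PiCFL {M : NPDA S H} (hM : M.Terminates)
    (R : Set (Option H × Option H)) :
    (⟨S ⊕ H, inferInstance, (beatenLang M R)ᶜ⟩ : Lang) ∈ PiCFL 3 := by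
  refine ⟨⟨Bool × H, inferInstance, (mismatchLang H)ᶜ⟩, match_mem_PiCFL H,
    (beatsController S R).sim M, Controller.sim_terminates hM, fun x => ?_⟩
  change x ∈ (beatenLang M R)ᶜᶜ ↔ _
  rw [compl_compl]
  exact (accepts_sim_beatsController_iff hM).symm

/-- The query interleaves the input with the output in the order in which they arise; `beatenLang`
separates the two by their tags, so the order does not matter. -/
theorem mem_outputs_sim_copyController_iff {M : NPDA S H} (hM : M.Terminates)
    {R : Set (Option H × Option H)} {x : List S} {y : List H} :
    y ∈ ((copyController S H).sim M).outputs (beatenLang M R)ᶜ x ↔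
      y ∈ M.outputs x ∧ ∀ z ∈ M.outputs x, ¬ Beats R y z := by
  have hx : x.filterMap (copyController S H).proj = x := List.filterMap_some
  constructor
  · intro h
    obtain ⟨z, c, s, hz, ⟨rfl, rfl, rfl⟩, -, hs⟩ := Controller.exists_of_mem_outputs_sim hM
      copyController_preserved h
    rw [hx] at hz
    exact ⟨hz, fun z hz hb => hs ⟨z, hz, hb⟩⟩
  · rintro ⟨hy, hb⟩
    obtain ⟨c, s, g, ⟨rfl, rfl, rfl⟩, hg⟩ := Controller.exists_mem_outputs_sim
      (A := (beatenLang M R)ᶜ) (t := x) copyController_preservable (hx.symm ▸ hy) (by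
        rintro c s g ⟨rfl, rfl, rfl⟩
        exact ⟨trivial, fun ⟨z, hz, hz'⟩ => hb z hz hz'⟩)
    exact hg

/-- The best output is unbeaten and beats all others, so it is the only output that survives the
query. Leaving `R` free treats maxima and minima at once. -/
theorem mem_SigmaCFLSVt_of_forall_beats {f : MVFun} (M : NPDA f.In f.Out) (hM : M.Terminates)
    (R : Set (Option f.Out × Option f.Out))
    (hf : ∀ x, ∃ y, f.val x = {y} ∧ y ∈ M.outputs x ∧
      ∀ z ∈ M.outputs x, (z = y ∨ Beats R z y) ∧ ¬ Beats R y z) :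
    f ∈ SigmaCFLSVt 4 := by
  have := f.finIn
  have := f.finOut
  refine ⟨⟨⟨_, beatenLang_compl_mem_PiCFL hM R, (copyController f.In f.Out).sim M,
    Controller.sim_terminates hM, fun x => ?_⟩, fun x => ?_⟩, fun x => ?_⟩
  · obtain ⟨y, hy, hmem, hbest⟩ := hf x
    rw [hy]
    ext w
    rw [Set.mem_singleton_iff]
    refine Iff.trans ?_ (mem_outputs_sim_copyController_iff hM).symm
    constructor
    · rintro rfl
      exact ⟨hmem, fun z hz => (hbest z hz).2⟩
    · rintro ⟨hw, hw'⟩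
      exact (hbest w hw).1.resolve_right (hw' y hmem)
  · obtain ⟨y, hy, -⟩ := hf x
    rw [hy]
    exact Set.subsingleton_singleton
  · obtain ⟨y, hy, -⟩ := hf x
    rw [hy]
    exact Set.singleton_nonempty y

theorem OptCFL_subset_SigmaCFLSVt : OptCFL ⊆ SigmaCFLSVt 4 := by
  rintro f ⟨M, hM, hf | hf⟩
  · refine mem_SigmaCFLSVt_of_forall_beats M hM {p | lexRel f.ord.lt p.1 p.2} fun x => ?_
    obtain ⟨y, hy, hmem, hmax⟩ := hf x
    refine ⟨y, hy, hmem, fun z hz => ⟨(hmax z hz).imp_right lex_iff_exists_take_eq.1, fun h => ?_⟩⟩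
    have h' : List.Lex f.ord.lt y z := lex_iff_exists_take_eq.2 h
    rcases hmax z hz with rfl | h''
    · exact irrefl (r := List.Lex f.ord.lt) _ h'
    · exact asymm (r := List.Lex f.ord.lt) h' h''
  -- For minima the relation on the symbols is reversed; the end of a string then loses to every
  -- symbol when the roles of the two strings are exchanged accordingly.
  · refine mem_SigmaCFLSVt_of_forall_beats M hM {p | lexRel f.ord.lt p.2 p.1} fun x => ?_
    obtain ⟨y, hy, hmem, hmin⟩ := hf x
    have hb : ∀ {a b}, Beats {p | lexRel f.ord.lt p.2 p.1} a b ↔ List.Lex f.ord.lt b a := by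
      intro a b
      rw [lex_iff_exists_take_eq]
      exact exists_congr fun i => and_congr_left fun _ => eq_comm
    refine ⟨y, hy, hmem, fun z hz => ⟨(hmin z hz).imp_right hb.2, fun h => ?_⟩⟩
    have h' := hb.1 h
    rcases hmin z hz with rfl | h''
    · exact irrefl (r := List.Lex f.ord.lt) _ h'
    · exact asymm (r := List.Lex f.ord.lt) h' h''

theorem CFLSVt_subset_OptCFL : CFLSVt ⊆ OptCFL := by
  rintro f ⟨⟨⟨M, hM, hf⟩, hsv⟩, htot⟩
  refine ⟨M, hM, .inl fun x => ?_⟩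
  obtain ⟨y, hy⟩ := htot x
  refine ⟨y, (hsv x).eq_singleton_of_mem hy, ?_, fun z hz => .inl ?_⟩
  · rw [← hf]
    exact hy
  · rw [← hf] at hz
    exact hsv x hz hy

end CFLFun

theorem mainTheorem1 :
    (CFLFun.CFLSVt ⊂ CFLFun.OptCFL ∧ CFLFun.OptCFL ⊆ CFLFun.SigmaCFLSVt 4) ∧
      (CFLFun.maxPalPair ∈ CFLFun.OptCFL ∧ CFLFun.maxPalPair ∉ CFLFun.CFLSVt) := by
  have hmem := CFLFun.maxPalPair_mem_OptCFL
  have hnot := CFLFun.maxPalPair_notMem_CFLSVt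
  exact ⟨⟨⟨CFLFun.CFLSVt_subset_OptCFL, fun h => hnot (h hmem)⟩,
    CFLFun.OptCFL_subset_SigmaCFLSVt⟩, hmem, hnot⟩
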